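/- Let $\mathbb R^4_1$ be $\mathbb R^4$ with the Lorentz inner product $\langle v,w\rangle=v_1w_1+v_2w_2+v_3w_3-v_4w_4$. A stationary surface is a spacelike immersed surface in $\mathbb R^4_1$ with zero mean curvature. Let $k\ge 2$ be an integer, let $0<a<\pi/2$ be real, and on $M=\mathbb C\setminus\{0\}$ put $$\phi=z^k e^{az},\qquad \psi=-\frac{e^{az}}{z^k},\qquad \mathrm dh=e^{-az}\,\mathrm dz .$$ 1. (Regularity) $\phi,\psi,\mathrm dh$ are holomorphic on $M$, $\phi\ne\bar\psi$ everywhere on $M$, and $\mathrm dh$ has no zeros on $M$. 2. (Periods) For every closed piecewise $C^1$ path $\gamma$ in $M$, $$\oint_\gamma\phi\,\mathrm dh=-\overline{\oint_\gamma\psi\,\mathrm dh},\qquad \mathrm{Re}\oint_\gamma \mathrm dh=0=\mathrm{Re}\oint_\gamma\phi\psi\,\mathrm dh .$$ 3. $M$ has exactly two topological ends, one at $z=0$ and one at $z=\infty$. 4. $\phi$ and $\psi$ have essential singularities at $\infty$. 5. The formula $$x=2\,\mathrm{Re}\int\big(\phi+\psi,\,-i(\phi-\psi),\,1-\phi\psi,\,1+\phi\psi\big)\,\mathrm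 dh$$ defines a map $x:M\to\mathbb R^4_1$ (unique up to translation). It is a stationary surface, $z=u+iv$ is an isothermal coordinate of its induced metric, and this metric is complete. 6. Its normal bundle has a smooth frame of null vectors $y,y^*$ with $\langle y,y^*\rangle=1$ and $\det(x_u,x_v,y,y^*)>0$. For every such frame the Gauss maps $[y],[y^*]$ into the projective light cone are given by $\phi$ and $\bar\psi$, where $c\in\mathbb C$ corresponds to the class of $\big(\mathrm{Re}\,c,\ \mathrm{Im}\,c,\ \tfrac{1-|c|^2}{2},\ \tfrac{1+|c|^2}{2}\big)$. 7. Let $K$ be the Gaussian curvature, $K^\perp$ the normal curvature (the curvature of the normal bundle) and $\mathrm dM$ the area element of the surface. Then $$\int_M|K|\,\mathrm dM<\infty,\qquad \int_M|-K+iK^\perp|\,\mathrm dM<\infty,\qquad \int_M K\,\mathrm dM=-4\pi k,\qquad \int_M K^\perp\,\mathrm dM=0 .$$ Thus these are complete stationary surfaces of finite total curvature whose Gauss maps do not extend meromorphically to the end $z=\infty$, so Osserman's theorem on minimal surfaces in $\mathbb R^3$ does not carry over to stationary surfaces in $\mathbb R^4_1$. -/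

import Mathlib

open Set Filter Topology MeasureTheory
open scoped ContDiff ComplexConjugate Laplacian

noncomputable section

namespace StationarySurface

/-! ## Lorentz space and surfaces parametrized by a planar domain

A surface is a map `x : ℂ → (Fin 4 → ℝ)` considered on an open set `U` of parameters `z = u + i v`;
its values outside `U` are irrelevant. -/

/-- The Lorentz inner product `v₁ w₁ + v₂ w₂ + v₃ w₃ - v₄ w₄` of the space `ℝ⁴₁`. -/
def lorentz (v w : Fin 4 → ℝ) : ℝ :=
  v 0 * w 0 + v 1 * w 1 + v 2 * w 2 - v 3 * w 3

/-- The partial derivative with respect to `u = Re z`. -/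
def du {E : Type*} [NormedAddCommGroup E] [NormedSpace ℝ E] (f : ℂ → E) (z : ℂ) : E :=
  fderiv ℝ f z 1

/-- The partial derivative with respect to `v = Im z`. -/
def dv {E : Type*} [NormedAddCommGroup E] [NormedSpace ℝ E] (f : ℂ → E) (z : ℂ) : E :=
  fderiv ℝ f z Complex.I

/-- The first fundamental form (induced metric) `⟨dx(a), dx(b)⟩` at the point `z`. -/
def firstForm (x : ℂ → Fin 4 → ℝ) (z a b : ℂ) : ℝ :=
  lorentz (fderiv ℝ x z a) (fderiv ℝ x z b)

/-- The coefficient `E` of the first fundamental form `E du² + 2 F du dv + G dv²`. -/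
def coeffE (x : ℂ → Fin 4 → ℝ) (z : ℂ) : ℝ := firstForm x z 1 1

/-- The coefficient `F` of the first fundamental form `E du² + 2 F du dv + G dv²`. -/
def coeffF (x : ℂ → Fin 4 → ℝ) (z : ℂ) : ℝ := firstForm x z 1 Complex.I

/-- The coefficient `G` of the first fundamental form `E du² + 2 F du dv + G dv²`. -/
def coeffG (x : ℂ → Fin 4 → ℝ) (z : ℂ) : ℝ := firstForm x z Complex.I Complex.I

/-- A smooth spacelike immersion: the induced metric is positive definite at every point. -/
def IsSpacelikeImmersion (x : ℂ → Fin 4 → ℝ) (U : Set ℂ) : Prop :=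
  ContDiffOn ℝ ∞ x U ∧ ∀ z ∈ U, ∀ a : ℂ, a ≠ 0 → 0 < firstForm x z a a

/-- A vector is normal to the surface at `z`. -/
def IsNormalAt (x : ℂ → Fin 4 → ℝ) (z : ℂ) (n : Fin 4 → ℝ) : Prop :=
  lorentz n (du x z) = 0 ∧ lorentz n (dv x z) = 0

/-- Zero mean curvature: the trace with respect to the induced metric of the second fundamental
form (the normal part of the second derivatives of `x`) vanishes. Up to the positive factor
`2 (E G - F²)` the mean curvature vector is the normal part of `G x_uu - 2 F x_uv + E x_vv`. -/
def HasZeroMeanCurvature (x : ℂ → Fin 4 → ℝ) (U : Set ℂ) : Prop :=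
  ∀ z ∈ U, ∀ n : Fin 4 → ℝ, IsNormalAt x z n →
    lorentz (coeffG x z • du (du x) z - (2 * coeffF x z) • du (dv x) z
      + coeffE x z • dv (dv x) z) n = 0

/-- Stationary surfaces: spacelike immersions with zero mean curvature. -/
def IsStationary (x : ℂ → Fin 4 → ℝ) (U : Set ℂ) : Prop :=
  IsSpacelikeImmersion x U ∧ HasZeroMeanCurvature x U

/-- `z = u + i v` is an isothermal coordinate: the induced metric is `E (du² + dv²)`. -/
def IsIsothermal (x : ℂ → Fin 4 → ℝ) (U : Set ℂ) : Prop :=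
  ∀ z ∈ U, coeffE x z = coeffG x z ∧ coeffF x z = 0

/-! ## Completeness -/

/-- Piecewise continuously differentiable paths `[0, 1] → U`: continuous, and `C¹` (up to the end
points) on every closed interval whose interior avoids a certain finite set. -/
def IsPathIn (U : Set ℂ) (γ : ℝ → ℂ) : Prop :=
  ContinuousOn γ (Icc 0 1) ∧ MapsTo γ (Icc 0 1) U ∧
    ∃ P : Finset ℝ, ∀ a b : ℝ, 0 ≤ a → a < b → b ≤ 1 → Disjoint (Ioo a b) (P : Set ℝ) →
      ContDiffOn ℝ 1 γ (Icc a b)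

/-- The length of a path in the induced metric. -/
def inducedLength (x : ℂ → Fin 4 → ℝ) (γ : ℝ → ℂ) : ENNReal :=
  ∫⁻ t in Icc (0 : ℝ) 1, ENNReal.ofReal (Real.sqrt (firstForm x (γ t) (deriv γ t) (deriv γ t)))

/-- The distance of the induced metric: the infimum of the lengths of paths in `U`. -/
def inducedDist (x : ℂ → Fin 4 → ℝ) (U : Set ℂ) (p q : ℂ) : ENNReal :=
  ⨅ (γ : ℝ → ℂ) (_ : IsPathIn U γ ∧ γ 0 = p ∧ γ 1 = q), inducedLength x γ

/-- Completeness of the induced metric: Cauchy sequences converge. -/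
def IsCompleteSurface (x : ℂ → Fin 4 → ℝ) (U : Set ℂ) : Prop :=
  ∀ s : ℕ → ℂ, (∀ n, s n ∈ U) →
    (∀ ε : ENNReal, 0 < ε → ∃ N : ℕ, ∀ m n : ℕ, N ≤ m → N ≤ n →
      inducedDist x U (s m) (s n) < ε) →
    ∃ p ∈ U, Tendsto (fun n => inducedDist x U (s n) p) atTop (𝓝 0)

/-! ## Topological ends -/

/-- An end of the domain `U`: a choice, for every compact `K ⊆ U`, of a connected component of
`U \ K`, where larger compact sets are assigned smaller components (a point of the inverse limit
of the sets of components). -/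
def IsEnd (U : Set ℂ) (e : {K : Set ℂ // IsCompact K ∧ K ⊆ U} → Set ℂ) : Prop :=
  (∀ K, ∃ p ∈ U \ K.1, e K = connectedComponentIn (U \ K.1) p) ∧
    ∀ K L, K.1 ⊆ L.1 → e L ⊆ e K

/-- `U` has exactly two ends, one of them at `z = 0` (all its sets are punctured neighbourhoods
of `0`) and the other one at `z = ∞` (all its sets are neighbourhoods of `∞`). -/
def HasTwoEndsZeroInfty (U : Set ℂ) : Prop :=
  ∃ e₀ e₁ : {K : Set ℂ // IsCompact K ∧ K ⊆ U} → Set ℂ,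
    e₀ ≠ e₁ ∧ (∀ e, IsEnd U e ↔ e = e₀ ∨ e = e₁) ∧
    (∀ K, e₀ K ∈ 𝓝[≠] (0 : ℂ)) ∧ (∀ K, e₁ K ∈ cocompact ℂ)

/-! ## Curvature -/

/-- The density `√(E G - F²)` of the area measure. -/
def areaDensity (x : ℂ → Fin 4 → ℝ) (z : ℂ) : ℝ :=
  Real.sqrt (coeffE x z * coeffG x z - coeffF x z ^ 2)

/-- The area measure `dM` of the surface, with density `√(E G - F²)`. -/
def areaMeasure (x : ℂ → Fin 4 → ℝ) (U : Set ℂ) : Measure ℂ :=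
  (volume.restrict U).withDensity fun z => ENNReal.ofReal (areaDensity x z)

/-- The Gaussian curvature of a surface in an isothermal coordinate: the induced metric is
`e^{2ω} |dz|²` with `e^{2ω} = E`, and `K = -4 e^{-2ω} ω_{z z̄} = -(Δ ω) / E`,
`Δ = ∂²/∂u² + ∂²/∂v²`. -/
def gaussCurvature (x : ℂ → Fin 4 → ℝ) (z : ℂ) : ℝ :=
  -(Δ (fun w => Real.log (coeffE x w) / 2)) z / coeffE x z

/-- A smooth frame of null vectors `y`, `ystar` of the normal bundle with `⟨y, ystar⟩ = 1` and
`det (x_u, x_v, y, ystar) > 0`. -/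
structure IsNullNormalFrame (x : ℂ → Fin 4 → ℝ) (U : Set ℂ) (y ystar : ℂ → Fin 4 → ℝ) :
    Prop where
  smooth : ContDiffOn ℝ ∞ y U
  smooth_star : ContDiffOn ℝ ∞ ystar U
  normal : ∀ z ∈ U, IsNormalAt x z (y z)
  normal_star : ∀ z ∈ U, IsNormalAt x z (ystar z)
  null : ∀ z ∈ U, lorentz (y z) (y z) = 0
  null_star : ∀ z ∈ U, lorentz (ystar z) (ystar z) = 0
  pairing : ∀ z ∈ U, lorentz (y z) (ystar z) = 1
  oriented : ∀ z ∈ U, 0 < (Matrix.of ![du x z, dv x z, y z, ystar z]).det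

/-- The normal curvature `K^⊥`, computed in a null normal frame: `⟨dy, ystar⟩` is the connection
form of the normal bundle (so `∇^⊥ y = ⟨dy, ystar⟩ y`) and `K^⊥ dM = - d⟨dy, ystar⟩`. In an
isothermal coordinate with `E = e^{2ω}` and with `α = ⟨y_z, ystar⟩` this is
`-2 i e^{-2ω} (α_{z̄} - conj(α)_z)`. -/
def normalCurvature (x y ystar : ℂ → Fin 4 → ℝ) (z : ℂ) : ℝ :=
  (dv (fun w => lorentz (du y w) (ystar w)) z - du (fun w => lorentz (dv y w) (ystar w)) z)
    / areaDensity x z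

/-! ## Gauss maps and Weierstrass data -/

/-- The null vector that represents, in the projective light cone (a 2-sphere), the point
`c` of `ℂ ∪ {∞}`. -/
def nullVector (c : ℂ) : Fin 4 → ℝ :=
  ![c.re, c.im, (1 - ‖c‖ ^ 2) / 2, (1 + ‖c‖ ^ 2) / 2]

/-- The map `y` into the light cone represents `φ`: `[y] = [nullVector φ]` in the projective light
cone. -/
def Represents (y : ℂ → Fin 4 → ℝ) (φ : ℂ → ℂ) (U : Set ℂ) : Prop :=
  ∀ z ∈ U, ∃ c : ℝ, c ≠ 0 ∧ y z = c • nullVector (φ z)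

/-- The complex line integral `∫_γ f(z) dz`. -/
def lineIntegral (f : ℂ → ℂ) (γ : ℝ → ℂ) : ℂ :=
  ∫ t in (0 : ℝ)..1, f (γ t) * deriv γ t

/-- The coefficients of the Weierstrass form
`(φ + ψ, -i (φ - ψ), 1 - φ ψ, 1 + φ ψ) dh` with `dh = h dz`. -/
def weierstrassForm (φ ψ h : ℂ → ℂ) (i : Fin 4) (z : ℂ) : ℂ :=
  ![φ z + ψ z, -Complex.I * (φ z - ψ z), 1 - φ z * ψ z, 1 + φ z * ψ z] i * h z

/-- `x = 2 Re ∫ (φ + ψ, -i (φ - ψ), 1 - φ ψ, 1 + φ ψ) dh` on `U`, with `dh = h dz`, the integral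
being taken along arbitrary paths in `U`. -/
def IsWeierstrassSurface (φ ψ h : ℂ → ℂ) (U : Set ℂ) (x : ℂ → Fin 4 → ℝ) : Prop :=
  ∀ γ : ℝ → ℂ, IsPathIn U γ → ∀ i : Fin 4,
    x (γ 1) i - x (γ 0) i = 2 * (lineIntegral (weierstrassForm φ ψ h i) γ).re

/-- The regularity condition for data without poles on `U`: `φ`, `ψ` and `dh = h dz` are
holomorphic, `φ ≠ conj ψ` everywhere, and `dh` has no zeros (there are no poles of `φ`, `ψ` that
such zeros could cancel). -/
def RegularityCondition (φ ψ h : ℂ → ℂ) (U : Set ℂ) : Prop :=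
  (DifferentiableOn ℂ φ U ∧ DifferentiableOn ℂ ψ U ∧ DifferentiableOn ℂ h U) ∧
    (∀ z ∈ U, φ z ≠ conj (ψ z)) ∧ ∀ z ∈ U, h z ≠ 0

/-- The period condition along all closed paths, with `dh = h dz`. -/
def PeriodCondition (φ ψ h : ℂ → ℂ) (U : Set ℂ) : Prop :=
  ∀ γ : ℝ → ℂ, IsPathIn U γ → γ 0 = γ 1 →
    lineIntegral (fun z => φ z * h z) γ = -conj (lineIntegral (fun z => ψ z * h z) γ) ∧
    (lineIntegral h γ).re = 0 ∧
    (lineIntegral (fun z => φ z * ψ z * h z) γ).re = 0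

/-- `∞` is an essential singularity of `f`: `f` is holomorphic near `∞` (outside `∞`), and does
not extend meromorphically to `∞`. -/
def HasEssentialSingularityAtInfty (f : ℂ → ℂ) : Prop :=
  (∀ᶠ z in cocompact ℂ, AnalyticAt ℂ f z) ∧ ¬ MeromorphicAt (fun w => f w⁻¹) 0

/-! ## The family of examples -/

/-- The parameter domain `ℂ \ {0}`. -/
def puncturedPlane : Set ℂ := {0}ᶜ

/-- `φ = z^k e^{az}`. -/
def phi (k : ℕ) (a : ℝ) (z : ℂ) : ℂ := z ^ k * Complex.exp (a * z)

/-- `ψ = - e^{az} / z^k`. -/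
def psi (k : ℕ) (a : ℝ) (z : ℂ) : ℂ := -Complex.exp (a * z) / z ^ k

/-- `dh = e^{-az} dz`. -/
def dh (a : ℝ) (z : ℂ) : ℂ := Complex.exp (-(a * z))

end StationarySurface

end

/-!
Why the theorem holds.

*General data.* Let `x` be given by holomorphic data `φ, ψ, h dz` on an open set `U`, and put
`g = φ - ψ̄`. Locally `x` is twice the real part of a holomorphic curve, so `x` is harmonic, and its
induced metric is `4 |g|² |h|² |dz|²` (`IsWeierstrassSurface.firstForm_eq`); this gives the
stationary surface and its isothermal coordinate. The null vectors `N(φ)` and `N(ψ̄)` are normal to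
the surface and satisfy `⟨N(c), N(d)⟩ = -|c - d|² / 2`. A plane of signature `(1, 1)` contains only
two null lines, and the orientation tells them apart, so every admissible frame is
`y = λ N(φ)`, `y* = μ N(ψ̄)` with `λ μ |g|² = -2` (`IsWeierstrassSurface.frame_eq_smul`).
With `J = φ_z ψ̄_z̄ / g²` (`curvatureDensity`), the Laplacian of `log |g|` is `4 Re J`, and the
connection form of the normal bundle is `d log λ + 2 Re (φ_z dz / g)`, where the exact part is
harmless. Hence `(-K + i K^⊥) dM = 4 J du dv` (`IsWeierstrassSurface.gaussCurvature_mul`,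
`IsWeierstrassSurface.normalCurvature_mul`), and both total curvatures are read off from `∫ J`.

*The examples.* All four forms in the period condition are exact on `ℂ \ {0}`. Everything else is
governed by `q = -φ / ψ̄ = |z|^{2k} e^{2 i a Im z}`. Since `q = -1` would force `|z| = 1` and
`|2 a Im z| < π`, the function `1 + q` has no zeros, and even
`|1 + q| ≥ c (1 + |z|^{2k})` (`exists_le_norm_one_add_gaussRatio`). The metric is
`(2 |z|^{-k} |1 + q|)² |dz|²`; it dominates multiples of `|dz|²` and `|d(1/z)|²`, so it is complete
(`isCompleteSurface_of_le`). Finally `J = ∂_z (P / z̄)` with `P = (a z̄ - k) / (1 + q)`, so in polar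
coordinates `2 r J = P_r - (i / r) P_θ`. Both terms are absolutely integrable because `k ≥ 2`; the
second one integrates to `0` over circles, and the first one to `P(∞) - P(0) = k` over rays. Thus
`∫ J = π k` (`integral_curvatureDensity`), that is `∫ K dM = -4 π k` and `∫ K^⊥ dM = 0`.

*Ends and singularities.* The complement of a closed annulus around `0` in `ℂ \ {0}` has exactly
two components, a punctured disc and an exterior domain, and such annuli exhaust `ℂ \ {0}`
(`IsEnd.exists_eq_endComponent`). Along the positive real axis `φ` and `ψ` grow faster than every
power, so they have no meromorphic extension to `∞`.
-/


namespace StationarySurface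

/-! ### Line integrals along piecewise `C¹` paths -/

/-- By induction on the exceptional set `P`: one point is removed by splitting the interval. -/
theorem intervalIntegrable_deriv_of_piecewise {γ : ℝ → ℂ} (P : Finset ℝ) :
    ∀ a b : ℝ, a ≤ b →
      (∀ c d : ℝ, a ≤ c → c < d → d ≤ b → Disjoint (Ioo c d) (P : Set ℝ) →
        ContDiffOn ℝ 1 γ (Icc c d)) →
      IntervalIntegrable (deriv γ) volume a b := by
  induction P using Finset.induction_on with
  | empty =>
    intro a b hab h
    rcases hab.eq_or_lt with rfl | hlt
    · exact IntervalIntegrable.refl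
    have hc := h a b le_rfl hlt le_rfl (by simp)
    have := (hc.derivWithin (m := 0) (uniqueDiffOn_Icc hlt) (by simp)).continuousOn
    apply (this.intervalIntegrable_of_Icc (μ := volume) hab).congr_ae
    simp only [hab, uIoc_of_le]
    rw [← restrict_Ioo_eq_restrict_Ioc]
    filter_upwards [self_mem_ae_restrict measurableSet_Ioo] with x hx
    exact derivWithin_of_mem_nhds (Icc_mem_nhds hx.1 hx.2)
  | insert p P hp ih =>
    intro a b hab h
    -- an interval whose interior misses `p` needs no splitting at `p`
    have key : ∀ a' b' : ℝ, a ≤ a' → a' ≤ b' → b' ≤ b → p ∉ Ioo a' b' →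
        IntervalIntegrable (deriv γ) volume a' b' := by
      intro a' b' h1 h2 h3 hp'
      refine ih a' b' h2 fun c d hc hcd hd hdis => h c d (h1.trans hc) hcd (hd.trans h3) ?_
      rw [Finset.coe_insert, disjoint_insert_right]
      exact ⟨fun hm => hp' ⟨hc.trans_lt hm.1, hm.2.trans_le hd⟩, hdis⟩
    by_cases hpm : p ∈ Ioo a b
    · exact (key a p le_rfl hpm.1.le hpm.2.le (by simp)).trans
        (key p b hpm.1.le hpm.2.le le_rfl (by simp))
    · exact key a b le_rfl hab le_rfl hpm

theorem IsPathIn.intervalIntegrable_deriv {U : Set ℂ} {γ : ℝ → ℂ} (h : IsPathIn U γ) :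
    IntervalIntegrable (deriv γ) volume 0 1 := by
  obtain ⟨-, -, P, hP⟩ := h
  exact intervalIntegrable_deriv_of_piecewise P 0 1 zero_le_one
    fun c d hc hcd hd hdis => hP c d hc hcd hd hdis

theorem IsPathIn.exists_finset_differentiableAt {U : Set ℂ} {γ : ℝ → ℂ} (h : IsPathIn U γ) :
    ∃ P : Finset ℝ, ∀ t ∈ Ioo (0 : ℝ) 1 \ (P : Set ℝ), DifferentiableAt ℝ γ t := by
  obtain ⟨-, -, P, hP⟩ := h
  refine ⟨P, fun t ht => ?_⟩
  have hop : IsOpen (Ioo (0 : ℝ) 1 \ (P : Set ℝ)) :=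
    isOpen_Ioo.sdiff P.finite_toSet.isClosed
  obtain ⟨ε, hε, hsub⟩ := Metric.isOpen_iff.1 hop t ht
  rw [Real.ball_eq_Ioo] at hsub
  have hsub' : Icc (t - ε / 2) (t + ε / 2) ⊆ Ioo (0 : ℝ) 1 \ (P : Set ℝ) := by
    refine Subset.trans ?_ hsub
    intro s hs
    exact ⟨by linarith [hs.1], by linarith [hs.2]⟩
  have h1 := hsub' (left_mem_Icc.2 (by linarith))
  have h2 := hsub' (right_mem_Icc.2 (by linarith))
  have hc := hP (t - ε / 2) (t + ε / 2) h1.1.1.le (by linarith) h2.1.2.le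
    (disjoint_left.2 fun s hs hsP => (hsub' (Ioo_subset_Icc_self hs)).2 hsP)
  exact (hc.differentiableOn one_ne_zero).differentiableAt
    (Icc_mem_nhds (by linarith) (by linarith))

theorem IsPathIn.mono {U V : Set ℂ} {γ : ℝ → ℂ} (h : IsPathIn U γ) (hUV : U ⊆ V) :
    IsPathIn V γ :=
  ⟨h.1, h.2.1.mono_right hUV, h.2.2⟩

theorem IsPathIn.intervalIntegrable_mul_deriv {U : Set ℂ} {γ f : ℝ → ℂ} (h : IsPathIn U γ)
    (hf : ContinuousOn f (Icc 0 1)) :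
    IntervalIntegrable (fun t => f t * deriv γ t) volume 0 1 :=
  h.intervalIntegrable_deriv.continuousOn_mul (by rwa [uIcc_of_le zero_le_one])

/-- The fundamental theorem of calculus for complex line integrals. -/
theorem IsPathIn.lineIntegral_eq_sub {U : Set ℂ} {γ : ℝ → ℂ} (h : IsPathIn U γ) {F f : ℂ → ℂ}
    (hF : ∀ z ∈ U, HasDerivAt F (f z) z) (hf : ContinuousOn f U) :
    lineIntegral f γ = F (γ 1) - F (γ 0) := by
  obtain ⟨P, hP⟩ := h.exists_finset_differentiableAt
  refine integral_eq_of_hasDerivAt_off_countable_of_le (F ∘ γ) _ zero_le_one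
    P.finite_toSet.countable ?_ ?_ (h.intervalIntegrable_mul_deriv (hf.comp h.1 h.2.1))
  · exact ContinuousOn.comp (t := U) (fun z hz => (hF z hz).continuousAt.continuousWithinAt)
      h.1 h.2.1
  · intro t ht
    exact (hF _ (h.2.1 (Ioo_subset_Icc_self ht.1))).comp_of_eq t (hP t ht).hasDerivAt rfl

theorem isPathIn_segment {U : Set ℂ} {p q : ℂ} (h : segment ℝ p q ⊆ U) :
    IsPathIn U (fun t : ℝ => p + t * (q - p)) := by
  have hc : ContDiff ℝ 1 (fun t : ℝ => p + t * (q - p)) := by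
    have : ContDiff ℝ 1 (fun t : ℝ => (t : ℂ)) := Complex.ofRealCLM.contDiff
    fun_prop
  refine ⟨hc.continuous.continuousOn, fun t ht => h ?_, ∅, fun _ _ _ _ _ _ => hc.contDiffOn⟩
  rw [segment_eq_image']
  exact ⟨t, ht, by simp⟩

/-- If the metric dominates `|f dz|` and `f` has the primitive `F`, then `F` is distance
nonincreasing from the induced distance to the Euclidean one. -/
theorem edist_le_inducedDist {x : ℂ → Fin 4 → ℝ} {U : Set ℂ} {F f : ℂ → ℂ}
    (hF : ∀ z ∈ U, HasDerivAt F (f z) z) (hf : ContinuousOn f U)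
    (hle : ∀ z ∈ U, ∀ a : ℂ, ‖f z * a‖ ≤ Real.sqrt (firstForm x z a a)) (p q : ℂ) :
    edist (F q) (F p) ≤ inducedDist x U p q := by
  refine le_iInf₂ fun γ hγ => ?_
  obtain ⟨hγ, rfl, rfl⟩ := hγ
  rw [edist_eq_enorm_sub, ← hγ.lineIntegral_eq_sub hF hf, lineIntegral,
    intervalIntegral.integral_of_le zero_le_one, ← integral_Icc_eq_integral_Ioc]
  refine (enorm_integral_le_lintegral_enorm _).trans ?_
  refine setLIntegral_mono' measurableSet_Icc fun t ht => ?_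
  rw [← ofReal_norm]
  exact ENNReal.ofReal_le_ofReal (hle _ (hγ.2.1 ht) _)

/-! ### Partial derivatives of functions of a complex variable -/

section Partials

variable {E : Type*} [NormedAddCommGroup E] [NormedSpace ℝ E]

/-- `f` is real differentiable at `z`, with partial derivatives `fu` and `fv` with respect to the
real and the imaginary part. -/
def HasPartials (f : ℂ → E) (fu fv : E) (z : ℂ) : Prop :=
  HasFDerivAt f (Complex.reCLM.smulRight fu + Complex.imCLM.smulRight fv) z

theorem HasPartials.du_eq {f : ℂ → E} {fu fv : E} {z : ℂ} (h : HasPartials f fu fv z) :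
    du f z = fu := by
  simp [du, HasFDerivAt.fderiv h]

theorem HasPartials.dv_eq {f : ℂ → E} {fu fv : E} {z : ℂ} (h : HasPartials f fu fv z) :
    dv f z = fv := by
  simp [dv, HasFDerivAt.fderiv h]

theorem hasPartials_of_hasFDerivAt {f : ℂ → E} {L : ℂ →L[ℝ] E} {fu fv : E} {z : ℂ}
    (h : HasFDerivAt f L z) (hu : L 1 = fu) (hv : L Complex.I = fv) : HasPartials f fu fv z := by
  subst hu hv
  refine h.congr_fderiv (ContinuousLinearMap.ext fun a => ?_)
  have : a = a.re • (1 : ℂ) + a.im • Complex.I := by simp [Complex.re_add_im]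
  conv_lhs => rw [this, map_add, map_smul, map_smul]
  simp

theorem hasPartials_of_differentiableAt {f : ℂ → E} {z : ℂ} (h : DifferentiableAt ℝ f z) :
    HasPartials f (du f z) (dv f z) z :=
  hasPartials_of_hasFDerivAt h.hasFDerivAt rfl rfl

theorem HasPartials.congr {f g : ℂ → E} {fu fv gu gv : E} {z : ℂ} (h : HasPartials f fu fv z)
    (hfg : g =ᶠ[𝓝 z] f) (hu : gu = fu) (hv : gv = fv) : HasPartials g gu gv z := by
  subst hu hv
  exact HasFDerivAt.congr_of_eventuallyEq h hfg

theorem HasPartials.clm_comp {F : Type*} [NormedAddCommGroup F] [NormedSpace ℝ F] (L : E →L[ℝ] F)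
    {f : ℂ → E} {fu fv : E} {z : ℂ} (h : HasPartials f fu fv z) :
    HasPartials (fun w => L (f w)) (L fu) (L fv) z := by
  refine hasPartials_of_hasFDerivAt (L.hasFDerivAt.comp z h) ?_ ?_ <;> simp

theorem HasPartials.re {f : ℂ → ℂ} {fu fv : ℂ} {z : ℂ} (h : HasPartials f fu fv z) :
    HasPartials (fun w => (f w).re) fu.re fv.re z :=
  h.clm_comp Complex.reCLM

theorem HasPartials.conj {f : ℂ → ℂ} {fu fv : ℂ} {z : ℂ} (h : HasPartials f fu fv z) :
    HasPartials (fun w => conj (f w)) (conj fu) (conj fv) z :=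
  h.clm_comp (Complex.conjCLE : ℂ →L[ℝ] ℂ)

theorem HasPartials.add {f g : ℂ → E} {fu fv gu gv : E} {z : ℂ} (hf : HasPartials f fu fv z)
    (hg : HasPartials g gu gv z) : HasPartials (fun w => f w + g w) (fu + gu) (fv + gv) z := by
  refine hasPartials_of_hasFDerivAt (HasFDerivAt.add hf hg) ?_ ?_ <;> simp

theorem HasPartials.sub {f g : ℂ → E} {fu fv gu gv : E} {z : ℂ} (hf : HasPartials f fu fv z)
    (hg : HasPartials g gu gv z) : HasPartials (fun w => f w - g w) (fu - gu) (fv - gv) z := by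
  refine hasPartials_of_hasFDerivAt (HasFDerivAt.sub hf hg) ?_ ?_ <;> simp

theorem HasPartials.smul {f : ℂ → E} {r : ℂ → ℝ} {fu fv : E} {ru rv : ℝ} {z : ℂ}
    (hr : HasPartials r ru rv z) (hf : HasPartials f fu fv z) :
    HasPartials (fun w => r w • f w) (r z • fu + ru • f z) (r z • fv + rv • f z) z := by
  refine hasPartials_of_hasFDerivAt (HasFDerivAt.smul hr hf) ?_ ?_ <;> simp [mul_comm]

theorem HasPartials.mul {A : Type*} [NormedCommRing A] [NormedAlgebra ℝ A] {f g : ℂ → A}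
    {fu fv gu gv : A} {z : ℂ} (hf : HasPartials f fu fv z)
    (hg : HasPartials g gu gv z) :
    HasPartials (fun w => f w * g w) (f z * gu + g z * fu) (f z * gv + g z * fv) z := by
  refine hasPartials_of_hasFDerivAt (HasFDerivAt.mul hf hg) ?_ ?_ <;> simp [mul_comm]

theorem HasPartials.holomorphic_comp {f G : ℂ → ℂ} {fu fv G' : ℂ} {z : ℂ}
    (hG : HasDerivAt G G' (f z)) (hf : HasPartials f fu fv z) :
    HasPartials (fun w => G (f w)) (G' * fu) (G' * fv) z := by
  refine hasPartials_of_hasFDerivAt (hG.complexToReal_fderiv.comp z hf) ?_ ?_ <;> simp [mul_comm]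

theorem HasPartials.real_comp {f : ℂ → ℝ} {G : ℝ → ℝ} {fu fv G' : ℝ} {z : ℂ}
    (hG : HasDerivAt G G' (f z)) (hf : HasPartials f fu fv z) :
    HasPartials (fun w => G (f w)) (G' * fu) (G' * fv) z := by
  refine hasPartials_of_hasFDerivAt (hG.hasFDerivAt.comp z hf) ?_ ?_ <;> simp [mul_comm]

theorem hasPartials_of_hasDerivAt {f : ℂ → ℂ} {f' z : ℂ} (h : HasDerivAt f f' z) :
    HasPartials f f' (Complex.I * f') z := by
  refine hasPartials_of_hasFDerivAt h.complexToReal_fderiv ?_ ?_ <;> simp [mul_comm]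

theorem HasPartials.div {f g : ℂ → ℂ} {fu fv gu gv : ℂ} {z : ℂ} (hf : HasPartials f fu fv z)
    (hg : HasPartials g gu gv z) (h0 : g z ≠ 0) :
    HasPartials (fun w => f w / g w) (fu / g z - f z * gu / g z ^ 2)
      (fv / g z - f z * gv / g z ^ 2) z := by
  have := hf.mul (hg.holomorphic_comp (hasDerivAt_inv h0))
  refine this.congr (by simp [div_eq_mul_inv]) ?_ ?_ <;> field_simp <;> ring

/-- The logarithmic derivative of the modulus: `d log |g| = Re (dg / g)`. -/
theorem HasPartials.log_normSq {g : ℂ → ℂ} {gu gv : ℂ} {z : ℂ} (hg : HasPartials g gu gv z)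
    (h0 : g z ≠ 0) :
    HasPartials (fun w => Real.log (Complex.normSq (g w)) / 2) (gu / g z).re (gv / g z).re z := by
  have h1 : HasPartials (fun w => Complex.normSq (g w)) (2 * (gu * conj (g z)).re)
      (2 * (gv * conj (g z)).re) z := by
    refine (hg.mul hg.conj).re.congr (.of_forall fun w => ?_) ?_ ?_
    · simp [Complex.mul_conj]
    · simp; ring
    · simp; ring
  have hn : Complex.normSq (g z) ≠ 0 := by simpa using h0
  have h2 := (HasPartials.real_comp (f := fun w => Complex.normSq (g w))
    (Real.hasDerivAt_log hn) h1).mul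
    (hasPartials_of_differentiableAt (differentiableAt_const (1 / 2 : ℝ)) (z := z))
  have hc : du (fun _ : ℂ => (1 / 2 : ℝ)) z = 0 ∧ dv (fun _ : ℂ => (1 / 2 : ℝ)) z = 0 := by
    simp [du, dv]
  rw [hc.1, hc.2] at h2
  refine h2.congr (.of_forall fun w => by ring) ?_ ?_ <;>
  · rw [Complex.div_re]; simp; field_simp

theorem fderiv_fderiv_apply {f : ℂ → E} {z : ℂ} (h : ContDiffAt ℝ 2 f z) (a b : ℂ) :
    fderiv ℝ (fun w => fderiv ℝ f w a) z b = fderiv ℝ (fderiv ℝ f) z b a := by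
  have hd : DifferentiableAt ℝ (fderiv ℝ f) z :=
    (h.fderiv_right (m := 1) (by norm_num)).differentiableAt one_ne_zero
  rw [fderiv_clm_apply hd (differentiableAt_const a)]
  simp

theorem dv_du_eq_du_dv {f : ℂ → E} {z : ℂ} (h : ContDiffAt ℝ 2 f z) :
    dv (du f) z = du (dv f) z := by
  have := (h.isSymmSndFDerivAt (by simp)).eq 1 Complex.I
  calc dv (du f) z = fderiv ℝ (fderiv ℝ f) z Complex.I 1 := fderiv_fderiv_apply h 1 Complex.I
    _ = fderiv ℝ (fderiv ℝ f) z 1 Complex.I := this.symm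
    _ = du (dv f) z := (fderiv_fderiv_apply h Complex.I 1).symm

theorem laplacian_eq_du_du_add_dv_dv {f : ℂ → E} {z : ℂ} (h : ContDiffAt ℝ 2 f z) :
    (Δ f) z = du (du f) z + dv (dv f) z := by
  rw [InnerProductSpace.laplacian_eq_iteratedFDeriv_complexPlane]
  simp only [iteratedFDeriv_two_apply]
  have h1 : du (du f) z = fderiv ℝ (fderiv ℝ f) z 1 1 := fderiv_fderiv_apply h 1 1
  have h2 : dv (dv f) z = fderiv ℝ (fderiv ℝ f) z Complex.I Complex.I :=
    fderiv_fderiv_apply h Complex.I Complex.I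
  rw [h1, h2]
  simp

end Partials

/-! ### The metric of a surface with a Weierstrass representation -/

section Weierstrass

variable {φ ψ h : ℂ → ℂ} {U : Set ℂ} {x : ℂ → Fin 4 → ℝ}

theorem RegularityCondition.differentiableOn_weierstrassForm (hr : RegularityCondition φ ψ h U)
    (i : Fin 4) : DifferentiableOn ℂ (weierstrassForm φ ψ h i) U := by
  obtain ⟨⟨h1, h2, h3⟩, -, -⟩ := hr
  fin_cases i
  · exact (h1.add h2).mul h3
  · exact ((h1.sub h2).const_mul _).mul h3
  · exact ((h1.mul h2).const_sub 1).mul h3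
  · exact ((h1.mul h2).const_add 1).mul h3

/-- Near every point of the domain, `x` is twice the real part of a holomorphic curve. -/
theorem IsWeierstrassSurface.exists_local_primitive (hr : RegularityCondition φ ψ h U)
    (hx : IsWeierstrassSurface φ ψ h U x) (hU : IsOpen U) {p : ℂ} (hp : p ∈ U) :
    ∃ (r : ℝ) (F : Fin 4 → ℂ → ℂ), 0 < r ∧ Metric.ball p r ⊆ U ∧
      (∀ i, ∀ z ∈ Metric.ball p r, HasDerivAt (F i) (weierstrassForm φ ψ h i z) z) ∧
      ∀ z ∈ Metric.ball p r, ∀ i, x z i = 2 * (F i z).re := by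
  obtain ⟨r, hr0, hsub⟩ := Metric.isOpen_iff.1 hU p hp
  have hprim : ∀ i, ∃ F : ℂ → ℂ, F p = ((x p i / 2 : ℝ) : ℂ) ∧
      ∀ z ∈ Metric.ball p r, HasDerivAt F (weierstrassForm φ ψ h i z) z := fun i =>
    ((hr.differentiableOn_weierstrassForm i).mono hsub).isExactOn_ball.with_val_at p _
  choose F hFp hF using hprim
  refine ⟨r, F, hr0, hsub, hF, fun z hz i => ?_⟩
  have hseg : segment ℝ p z ⊆ Metric.ball p r :=
    (convex_ball p r).segment_subset (Metric.mem_ball_self hr0) hz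
  have hγ := isPathIn_segment hseg
  have h1 := hx _ (hγ.mono hsub) i
  rw [hγ.lineIntegral_eq_sub (hF i)
    ((hr.differentiableOn_weierstrassForm i).continuousOn.mono hsub)] at h1
  simp only [Complex.ofReal_one, one_mul, Complex.ofReal_zero, zero_mul, add_zero,
    add_sub_cancel, hFp, Complex.sub_re, Complex.ofReal_re] at h1
  linarith

theorem IsWeierstrassSurface.hasPartials (hr : RegularityCondition φ ψ h U)
    (hx : IsWeierstrassSurface φ ψ h U x) (hU : IsOpen U) {p : ℂ} (hp : p ∈ U) :
    HasPartials x (fun i => 2 * (weierstrassForm φ ψ h i p).re)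
      (fun i => 2 * (Complex.I * weierstrassForm φ ψ h i p).re) p := by
  obtain ⟨r, F, hr0, hsub, hF, hxF⟩ := hx.exists_local_primitive hr hU hp
  have hmem : Metric.ball p r ∈ 𝓝 p := Metric.ball_mem_nhds p hr0
  have hi : ∀ i, HasFDerivAt (fun w => x w i)
      (Complex.reCLM.smulRight (2 * (weierstrassForm φ ψ h i p).re) +
        Complex.imCLM.smulRight (2 * (Complex.I * weierstrassForm φ ψ h i p).re)) p := by
    intro i
    have h1 := (hasPartials_of_hasDerivAt (hF i p (mem_of_mem_nhds hmem))).re.clm_comp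
      ((2 : ℝ) • ContinuousLinearMap.id ℝ ℝ)
    refine h1.congr ?_ (by simp) (by simp)
    filter_upwards [hmem] with z hz
    simp [hxF z hz i]
  refine (hasFDerivAt_pi.2 hi).congr_fderiv (ContinuousLinearMap.ext fun a => ?_)
  ext i
  simp

theorem IsWeierstrassSurface.contDiffOn (hr : RegularityCondition φ ψ h U)
    (hx : IsWeierstrassSurface φ ψ h U x) (hU : IsOpen U) : ContDiffOn ℝ ∞ x U := by
  intro p hp
  obtain ⟨r, F, hr0, hsub, hF, hxF⟩ := hx.exists_local_primitive hr hU hp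
  have hmem : Metric.ball p r ∈ 𝓝 p := Metric.ball_mem_nhds p hr0
  refine ContDiffAt.contDiffWithinAt (contDiffAt_pi.2 fun i => ?_)
  have h1 : ContDiffOn ℂ ∞ (F i) (Metric.ball p r) :=
    DifferentiableOn.contDiffOn
      (fun z hz => (hF i z hz).differentiableAt.differentiableWithinAt) Metric.isOpen_ball
  have h2 : ContDiffAt ℝ ∞ (F i) p := (h1.contDiffAt hmem).restrict_scalars ℝ
  have h3 : ContDiffAt ℝ ∞ (fun z => 2 * (F i z).re) p :=
    contDiffAt_const.mul (Complex.reCLM.contDiff.contDiffAt.comp p h2)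
  refine h3.congr_of_eventuallyEq ?_
  filter_upwards [hmem] with z hz using hxF z hz i

/-- The factor `4 |φ - ψ̄|² |h|²` of the metric of the surface with Weierstrass data
`φ, ψ, h dz`. -/
noncomputable def conformalFactor (φ ψ h : ℂ → ℂ) (z : ℂ) : ℝ :=
  4 * Complex.normSq (φ z - conj (ψ z)) * Complex.normSq (h z)

theorem RegularityCondition.sub_ne_zero (hr : RegularityCondition φ ψ h U) {z : ℂ} (hz : z ∈ U) :
    φ z - conj (ψ z) ≠ 0 :=
  _root_.sub_ne_zero.2 (hr.2.1 z hz)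

theorem RegularityCondition.conformalFactor_pos (hr : RegularityCondition φ ψ h U) {z : ℂ}
    (hz : z ∈ U) : 0 < conformalFactor φ ψ h z := by
  have h1 := Complex.normSq_pos.2 (hr.sub_ne_zero hz)
  have h2 := Complex.normSq_pos.2 (hr.2.2 z hz)
  unfold conformalFactor
  positivity

theorem IsWeierstrassSurface.firstForm_eq (hr : RegularityCondition φ ψ h U)
    (hx : IsWeierstrassSurface φ ψ h U x) (hU : IsOpen U) {z : ℂ} (hz : z ∈ U) (a b : ℂ) :
    firstForm x z a b = conformalFactor φ ψ h z * (a * conj b).re := by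
  have hd : fderiv ℝ x z = _ := HasFDerivAt.fderiv (hx.hasPartials hr hU hz)
  rw [firstForm, hd]
  simp [lorentz, weierstrassForm, conformalFactor, Complex.normSq_apply]
  ring

theorem IsWeierstrassSurface.coeffE_eq (hr : RegularityCondition φ ψ h U)
    (hx : IsWeierstrassSurface φ ψ h U x) (hU : IsOpen U) {z : ℂ} (hz : z ∈ U) :
    coeffE x z = conformalFactor φ ψ h z := by
  simp [coeffE, hx.firstForm_eq hr hU hz]

theorem IsWeierstrassSurface.coeffG_eq (hr : RegularityCondition φ ψ h U)
    (hx : IsWeierstrassSurface φ ψ h U x) (hU : IsOpen U) {z : ℂ} (hz : z ∈ U) :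
    coeffG x z = conformalFactor φ ψ h z := by
  simp [coeffG, hx.firstForm_eq hr hU hz]

theorem IsWeierstrassSurface.coeffF_eq (hr : RegularityCondition φ ψ h U)
    (hx : IsWeierstrassSurface φ ψ h U x) (hU : IsOpen U) {z : ℂ} (hz : z ∈ U) :
    coeffF x z = 0 := by
  simp [coeffF, hx.firstForm_eq hr hU hz]

theorem IsWeierstrassSurface.areaDensity_eq (hr : RegularityCondition φ ψ h U)
    (hx : IsWeierstrassSurface φ ψ h U x) (hU : IsOpen U) {z : ℂ} (hz : z ∈ U) :
    areaDensity x z = conformalFactor φ ψ h z := by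
  rw [areaDensity, hx.coeffE_eq hr hU hz, hx.coeffG_eq hr hU hz, hx.coeffF_eq hr hU hz]
  have := (hr.conformalFactor_pos hz).le
  simp [Real.sqrt_mul_self this]

theorem IsWeierstrassSurface.isIsothermal (hr : RegularityCondition φ ψ h U)
    (hx : IsWeierstrassSurface φ ψ h U x) (hU : IsOpen U) : IsIsothermal x U := fun _ hz =>
  ⟨(hx.coeffE_eq hr hU hz).trans (hx.coeffG_eq hr hU hz).symm, hx.coeffF_eq hr hU hz⟩

/-- In isothermal coordinates zero mean curvature means that `x` is harmonic. -/
theorem IsWeierstrassSurface.isStationary (hr : RegularityCondition φ ψ h U)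
    (hx : IsWeierstrassSurface φ ψ h U x) (hU : IsOpen U) : IsStationary x U := by
  refine ⟨⟨hx.contDiffOn hr hU, fun z hz a ha => ?_⟩, fun z hz n _ => ?_⟩
  · rw [hx.firstForm_eq hr hU hz, Complex.mul_conj, Complex.ofReal_re]
    exact mul_pos (hr.conformalFactor_pos hz) (Complex.normSq_pos.2 ha)
  · have hnhds : U ∈ 𝓝 z := hU.mem_nhds hz
    have hW : ∀ i, HasDerivAt (weierstrassForm φ ψ h i)
        (deriv (weierstrassForm φ ψ h i) z) z := fun i =>
      ((hr.differentiableOn_weierstrassForm i).differentiableAt hnhds).hasDerivAt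
    have huu : ∀ i, du (du x) z i = 2 * (deriv (weierstrassForm φ ψ h i) z).re := by
      intro i
      have h1 : HasPartials (fun w => du x w) (fun i => 2 * (deriv (weierstrassForm φ ψ h i) z).re)
          (fun i => 2 * (Complex.I * deriv (weierstrassForm φ ψ h i) z).re) z := by
        have h2 : ∀ i, HasFDerivAt (fun w => du x w i) _ z := fun i =>
          ((hasPartials_of_hasDerivAt (hW i)).re.clm_comp
            ((2 : ℝ) • ContinuousLinearMap.id ℝ ℝ)).congr (g := fun w => du x w i) (by
              filter_upwards [hnhds] with w hw
              simp [(hx.hasPartials hr hU hw).du_eq]) rfl rfl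
        refine (hasFDerivAt_pi.2 h2).congr_fderiv (ContinuousLinearMap.ext fun a => ?_)
        ext i
        simp
      exact congrFun h1.du_eq i
    have hvv : ∀ i, dv (dv x) z i = -(2 * (deriv (weierstrassForm φ ψ h i) z).re) := by
      intro i
      have h1 : HasPartials (fun w => dv x w)
          (fun i => 2 * (Complex.I * deriv (weierstrassForm φ ψ h i) z).re)
          (fun i => 2 * (Complex.I * (Complex.I * deriv (weierstrassForm φ ψ h i) z)).re) z := by
        have h2 : ∀ i, HasFDerivAt (fun w => dv x w i) _ z := fun i =>
          ((hasPartials_of_hasDerivAt ((hW i).const_mul Complex.I)).re.clm_comp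
            ((2 : ℝ) • ContinuousLinearMap.id ℝ ℝ)).congr (g := fun w => dv x w i) (by
              filter_upwards [hnhds] with w hw
              simp [(hx.hasPartials hr hU hw).dv_eq]) rfl rfl
        refine (hasFDerivAt_pi.2 h2).congr_fderiv (ContinuousLinearMap.ext fun a => ?_)
        ext i
        simp
      rw [show dv (dv x) z = _ from h1.dv_eq]
      simp
    rw [hx.coeffE_eq hr hU hz, hx.coeffG_eq hr hU hz, hx.coeffF_eq hr hU hz]
    simp only [lorentz, Pi.add_apply, Pi.sub_apply, Pi.smul_apply, smul_eq_mul, huu, hvv]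
    ring

end Weierstrass

/-! ### Gaussian curvature -/

section Curvature

variable {φ ψ h : ℂ → ℂ} {U : Set ℂ} {x : ℂ → Fin 4 → ℝ}

/-- The complex density `φ_z ψ̄_z̄ / (φ - ψ̄)²`; four times its value is
`(-K + i K^⊥) dM / (du dv)`. -/
noncomputable def curvatureDensity (φ ψ : ℂ → ℂ) (z : ℂ) : ℂ :=
  deriv φ z * conj (deriv ψ z) / (φ z - conj (ψ z)) ^ 2

theorem hasDerivAt_of_isOpen (hU : IsOpen U) {f : ℂ → ℂ} (hf : DifferentiableOn ℂ f U) {z : ℂ}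
    (hz : z ∈ U) : HasDerivAt f (deriv f z) z :=
  (hf.differentiableAt (hU.mem_nhds hz)).hasDerivAt

theorem contDiffAt_of_isOpen (hU : IsOpen U) {f : ℂ → ℂ} (hf : DifferentiableOn ℂ f U) {z : ℂ}
    (hz : z ∈ U) : ContDiffAt ℝ ∞ f z :=
  ((hf.contDiffOn hU).contDiffAt (n := ∞) (hU.mem_nhds hz)).restrict_scalars ℝ

/-- The partial derivatives of `φ - ψ̄` for holomorphic `φ` and `ψ`. -/
theorem hasPartials_sub_conj (hU : IsOpen U) (hφ : DifferentiableOn ℂ φ U)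
    (hψ : DifferentiableOn ℂ ψ U) {z : ℂ} (hz : z ∈ U) :
    HasPartials (fun w => φ w - conj (ψ w)) (deriv φ z - conj (deriv ψ z))
      (Complex.I * (deriv φ z + conj (deriv ψ z))) z := by
  refine ((hasPartials_of_hasDerivAt (hasDerivAt_of_isOpen hU hφ hz)).sub
    (hasPartials_of_hasDerivAt (hasDerivAt_of_isOpen hU hψ hz)).conj).congr
    (.of_forall fun w => rfl) rfl ?_
  simp
  ring

theorem contDiffAt_conformalFactor (hr : RegularityCondition φ ψ h U) (hU : IsOpen U) {z : ℂ}
    (hz : z ∈ U) : ContDiffAt ℝ ∞ (conformalFactor φ ψ h) z := by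
  have h1 := contDiffAt_of_isOpen hU hr.1.1 hz
  have h2 := contDiffAt_of_isOpen hU hr.1.2.1 hz
  have h3 := contDiffAt_of_isOpen hU hr.1.2.2 hz
  have hn : ∀ {f : ℂ → ℂ}, ContDiffAt ℝ ∞ f z →
      ContDiffAt ℝ ∞ (fun w => Complex.normSq (f w)) z := by
    intro f hf
    have hre := Complex.reCLM.contDiff.contDiffAt.comp z hf
    have him := Complex.imCLM.contDiff.contDiffAt.comp z hf
    simp only [Complex.normSq_apply]
    exact (hre.mul hre).add (him.mul him)
  have h4 : ContDiffAt ℝ ∞ (fun w => φ w - conj (ψ w)) z :=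
    h1.sub ((Complex.conjCLE : ℂ →L[ℝ] ℂ).contDiff.contDiffAt.comp z h2)
  exact (contDiffAt_const.mul (hn h4)).mul (hn h3)

/-- `Δ ω = 4 Re (φ_z ψ̄_z̄ / (φ - ψ̄)²)` for the metric `e^{2ω} |dz|²`. -/
theorem IsWeierstrassSurface.gaussCurvature_mul (hr : RegularityCondition φ ψ h U)
    (hx : IsWeierstrassSurface φ ψ h U x) (hU : IsOpen U) {z : ℂ} (hz : z ∈ U) :
    conformalFactor φ ψ h z * gaussCurvature x z = -4 * (curvatureDensity φ ψ z).re := by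
  obtain ⟨⟨hφ, hψ, hh⟩, -, hh0⟩ := id hr
  have hE : ∀ w ∈ U, Real.log (coeffE x w) / 2 =
      Real.log 4 / 2 + (Real.log (Complex.normSq (φ w - conj (ψ w))) / 2
        + Real.log (Complex.normSq (h w)) / 2) := by
    intro w hw
    have h1 := Complex.normSq_pos.2 (hr.sub_ne_zero hw)
    have h2 := Complex.normSq_pos.2 (hh0 w hw)
    rw [hx.coeffE_eq hr hU hw, conformalFactor, Real.log_mul (by positivity) h2.ne',
      Real.log_mul (by norm_num) h1.ne']
    ring
  have hP : ∀ w ∈ U, HasPartials (fun w => Real.log (coeffE x w) / 2)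
      ((deriv φ w - conj (deriv ψ w)) / (φ w - conj (ψ w)) + deriv h w / h w).re
      (Complex.I * (deriv φ w + conj (deriv ψ w)) / (φ w - conj (ψ w))
        + Complex.I * (deriv h w / h w)).re w := by
    intro w hw
    have h1 := (hasPartials_sub_conj hU hφ hψ hw).log_normSq (hr.sub_ne_zero hw)
    have h2 := (hasPartials_of_hasDerivAt (hasDerivAt_of_isOpen hU hh hw)).log_normSq (hh0 w hw)
    have h3 := (hasPartials_of_differentiableAt
      (differentiableAt_const (Real.log 4 / 2)) (z := w)).add (h1.add h2)
    refine h3.congr ?_ ?_ ?_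
    · filter_upwards [hU.mem_nhds hw] with w' hw' using hE w' hw'
    · simp [du]
    · simp [dv, mul_div_assoc]
  have hφ2 := hasPartials_of_hasDerivAt (hasDerivAt_of_isOpen hU (hφ.deriv hU) hz)
  have hψ2 := hasPartials_of_hasDerivAt (hasDerivAt_of_isOpen hU (hψ.deriv hU) hz)
  have hh2 := hasPartials_of_hasDerivAt (hasDerivAt_of_isOpen hU (hh.deriv hU) hz)
  have hh1 := hasPartials_of_hasDerivAt (hasDerivAt_of_isOpen hU hh hz)
  have hI := hasPartials_of_hasDerivAt (hasDerivAt_const z Complex.I)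
  have hg := hasPartials_sub_conj hU hφ hψ hz
  have hg0 := hr.sub_ne_zero hz
  have huu := (((hφ2.sub hψ2.conj).div hg hg0).add (hh2.div hh1 (hh0 z hz))).re.congr
    (g := du fun w => Real.log (coeffE x w) / 2) (by
      filter_upwards [hU.mem_nhds hz] with w hw using (hP w hw).du_eq) rfl rfl
  have hvv := (((hI.mul (hφ2.add hψ2.conj)).div hg hg0).add
      (hI.mul (hh2.div hh1 (hh0 z hz)))).re.congr
    (g := dv fun w => Real.log (coeffE x w) / 2) (by
      filter_upwards [hU.mem_nhds hz] with w hw using (hP w hw).dv_eq) rfl rfl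
  have hE0 := hr.conformalFactor_pos hz
  have hC2 : ContDiffAt ℝ 2 (fun w => Real.log (coeffE x w) / 2) z := by
    have h1 : ContDiffAt ℝ 2 (conformalFactor φ ψ h) z :=
      contDiffAt_infty.1 (contDiffAt_conformalFactor hr hU hz) 2
    refine ((h1.log hE0.ne').div_const 2).congr_of_eventuallyEq ?_
    filter_upwards [hU.mem_nhds hz] with w hw
    rw [hx.coeffE_eq hr hU hw]
  rw [gaussCurvature, laplacian_eq_du_du_add_dv_dv hC2, huu.du_eq, hvv.dv_eq,
    hx.coeffE_eq hr hU hz, mul_div_cancel₀ _ hE0.ne', curvatureDensity, ← Complex.add_re,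
    ← Complex.re_ofReal_mul, neg_eq_iff_eq_neg, ← Complex.neg_re]
  congr 1
  have hh0' := hh0 z hz
  simp only [map_mul, Complex.conj_I]
  push_cast
  field_simp
  ring_nf
  simp only [Complex.I_sq]
  ring

/-! ### The curvature of the normal bundle -/

/-- The product of two normalized null vectors is `-|c - d|² / 2`; it is negative for `c ≠ d`, so
that the null vectors of `φ` and `ψ̄` are independent. -/
theorem lorentz_nullVector (c d : ℂ) :
    lorentz (nullVector c) (nullVector d) = -Complex.normSq (c - d) / 2 := by
  simp [lorentz, nullVector, ← Complex.normSq_eq_norm_sq, Complex.normSq_apply]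
  ring

/-- The normalization of `nullVector` makes the scalar in `y = c • nullVector φ` the smooth
function `y 2 + y 3`. -/
theorem nullVector_two_add_three (c : ℂ) : nullVector c 2 + nullVector c 3 = 1 := by
  simp [nullVector]
  ring

theorem det_four (a b c d : Fin 4 → ℝ) : (Matrix.of ![a, b, c, d]).det =
    (a 0 * b 1 - a 1 * b 0) * (c 2 * d 3 - c 3 * d 2)
    - (a 0 * b 2 - a 2 * b 0) * (c 1 * d 3 - c 3 * d 1)
    + (a 0 * b 3 - a 3 * b 0) * (c 1 * d 2 - c 2 * d 1)
    + (a 1 * b 2 - a 2 * b 1) * (c 0 * d 3 - c 3 * d 0)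
    - (a 1 * b 3 - a 3 * b 1) * (c 0 * d 2 - c 2 * d 0)
    + (a 2 * b 3 - a 3 * b 2) * (c 0 * d 1 - c 1 * d 0) := by
  simp [Matrix.det_succ_row_zero, Fin.sum_univ_succ, Fin.succAbove]
  ring

theorem lorentz_comm (v w : Fin 4 → ℝ) : lorentz v w = lorentz w v := by
  simp only [lorentz]; ring

theorem eq_zero_of_lorentz_eq_zero {a b c d v : Fin 4 → ℝ}
    (hdet : (Matrix.of ![a, b, c, d]).det ≠ 0) (ha : lorentz v a = 0) (hb : lorentz v b = 0)
    (hc : lorentz v c = 0) (hd : lorentz v d = 0) : v = 0 := by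
  have h := Matrix.eq_zero_of_mulVec_eq_zero (v := ![v 0, v 1, v 2, -v 3]) hdet (by
    simp only [lorentz] at ha hb hc hd
    ext i
    fin_cases i <;> simp [Matrix.mulVec, dotProduct, Fin.sum_univ_four] <;> linarith)
  ext i
  have := congrFun h i
  fin_cases i <;> simpa using this

/-- In a plane spanned by two null vectors `t`, `s`, the pairs of null vectors with product `1`
are multiples of `(t, s)` or of `(s, t)`; the orientation singles out the first possibility. -/
theorem null_pair_eq_smul {X Y t s y y' : Fin 4 → ℝ}
    (hdet : (Matrix.of ![X, Y, t, s]).det < 0) (htt : lorentz t t = 0) (hss : lorentz s s = 0)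
    (hts : lorentz t s < 0) (htX : lorentz t X = 0) (htY : lorentz t Y = 0)
    (hsX : lorentz s X = 0) (hsY : lorentz s Y = 0)
    (hyX : lorentz y X = 0) (hyY : lorentz y Y = 0)
    (hyX' : lorentz y' X = 0) (hyY' : lorentz y' Y = 0)
    (hyy : lorentz y y = 0) (hyy' : lorentz y' y' = 0) (h1 : lorentz y y' = 1)
    (hor : 0 < (Matrix.of ![X, Y, y, y']).det) :
    ∃ l m : ℝ, y = l • t ∧ y' = m • s ∧ l * m * lorentz t s = 1 := by
  have hts0 := hts.ne
  have dec : ∀ w : Fin 4 → ℝ, lorentz w X = 0 → lorentz w Y = 0 →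
      w = (lorentz w s / lorentz t s) • t + (lorentz w t / lorentz t s) • s := by
    intro w hX hY
    rw [← sub_eq_zero]
    have lin : ∀ α β : ℝ, ∀ v : Fin 4 → ℝ, lorentz (w - (α • t + β • s)) v =
        lorentz w v - α * lorentz t v - β * lorentz s v := by
      intro α β v; simp [lorentz]; ring
    apply eq_zero_of_lorentz_eq_zero hdet.ne <;> rw [lin]
    · simp [hX, htX, hsX]
    · simp [hY, htY, hsY]
    · rw [htt, lorentz_comm s t]; field_simp; ring
    · rw [hss]; field_simp; ring
  have prod : ∀ α β α' β' : ℝ, lorentz (α • t + β • s) (α' • t + β' • s) =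
      (α * β' + β * α') * lorentz t s := by
    intro α β α' β'
    have : lorentz (α • t + β • s) (α' • t + β' • s) = α * α' * lorentz t t
        + β * β' * lorentz s s + (α * β' + β * α') * lorentz t s := by
      simp [lorentz]; ring
    rw [this, htt, hss]; ring
  obtain ⟨l, m, hl⟩ : ∃ l m : ℝ, y = l • t + m • s := ⟨_, _, dec y hyX hyY⟩
  obtain ⟨l', m', hl'⟩ : ∃ l m : ℝ, y' = l • t + m • s := ⟨_, _, dec y' hyX' hyY'⟩
  subst hl hl'
  rw [prod] at hyy hyy' h1
  have e1 : l * m = 0 := by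
    rcases mul_eq_zero.1 hyy with h | h
    · linarith
    · exact absurd h hts0
  have e2 : l' * m' = 0 := by
    rcases mul_eq_zero.1 hyy' with h | h
    · linarith
    · exact absurd h hts0
  rcases mul_eq_zero.1 e1 with rfl | rfl
  · have hm : m ≠ 0 := by rintro rfl; simp at h1
    have hl' : l' ≠ 0 := by rintro rfl; simp at h1
    have hm' : m' = 0 := by simpa [hl'] using e2
    subst hm'
    exfalso
    have : (Matrix.of ![X, Y, (0 : ℝ) • t + m • s, l' • t + (0 : ℝ) • s]).det =
        -(m * l') * (Matrix.of ![X, Y, t, s]).det := by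
      simp only [det_four]; simp; ring
    rw [this] at hor
    have hml : m * l' < 0 := by
      by_contra hcon
      nlinarith [mul_nonneg (not_lt.1 hcon) (neg_nonneg.2 hts.le)]
    nlinarith [mul_pos_of_neg_of_neg hml hdet]
  · have hl : l ≠ 0 := by rintro rfl; simp at h1
    have hm' : m' ≠ 0 := by rintro rfl; simp at h1
    have hl' : l' = 0 := by simpa [hm'] using e2
    subst hl'
    exact ⟨l, m', by simp, by simp, by simpa using h1⟩

theorem IsWeierstrassSurface.isNormalAt_nullVector (hr : RegularityCondition φ ψ h U)
    (hx : IsWeierstrassSurface φ ψ h U x) (hU : IsOpen U) {z : ℂ} (hz : z ∈ U) :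
    IsNormalAt x z (nullVector (φ z)) ∧ IsNormalAt x z (nullVector (conj (ψ z))) := by
  have hd := hx.hasPartials hr hU hz
  rw [IsNormalAt, IsNormalAt, hd.du_eq, hd.dv_eq]
  refine ⟨⟨?_, ?_⟩, ?_, ?_⟩ <;>
  · simp [lorentz, nullVector, weierstrassForm, ← Complex.normSq_eq_norm_sq, Complex.normSq_apply]
    ring

/-- The Gram determinant shows that this is `± 2 |φ - ψ̄|⁴ |h|²`; the negative sign decides which
of the two null directions belongs to `y`. -/
theorem IsWeierstrassSurface.det_nullVector (hr : RegularityCondition φ ψ h U)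
    (hx : IsWeierstrassSurface φ ψ h U x) (hU : IsOpen U) {z : ℂ} (hz : z ∈ U) :
    (Matrix.of ![du x z, dv x z, nullVector (φ z), nullVector (conj (ψ z))]).det =
      -2 * Complex.normSq (φ z - conj (ψ z)) ^ 2 * Complex.normSq (h z) := by
  have hd := hx.hasPartials hr hU hz
  rw [hd.du_eq, hd.dv_eq, det_four]
  simp [nullVector, weierstrassForm, ← Complex.normSq_eq_norm_sq, Complex.normSq_apply]
  ring

theorem IsWeierstrassSurface.det_nullVector_neg (hr : RegularityCondition φ ψ h U)
    (hx : IsWeierstrassSurface φ ψ h U x) (hU : IsOpen U) {z : ℂ} (hz : z ∈ U) :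
    (Matrix.of ![du x z, dv x z, nullVector (φ z), nullVector (conj (ψ z))]).det < 0 := by
  have h1 := Complex.normSq_pos.2 (hr.sub_ne_zero hz)
  have h2 := Complex.normSq_pos.2 (hr.2.2 z hz)
  rw [hx.det_nullVector hr hU hz]
  have : 0 < Complex.normSq (φ z - conj (ψ z)) ^ 2 * Complex.normSq (h z) := by positivity
  linarith

theorem IsWeierstrassSurface.frame_eq_smul (hr : RegularityCondition φ ψ h U)
    (hx : IsWeierstrassSurface φ ψ h U x) (hU : IsOpen U) {y ystar : ℂ → Fin 4 → ℝ}
    (hy : IsNullNormalFrame x U y ystar) {z : ℂ} (hz : z ∈ U) :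
    y z = (y z 2 + y z 3) • nullVector (φ z) ∧
    ystar z = (ystar z 2 + ystar z 3) • nullVector (conj (ψ z)) ∧
    (y z 2 + y z 3) * (ystar z 2 + ystar z 3) * Complex.normSq (φ z - conj (ψ z)) = -2 := by
  obtain ⟨hN, hN'⟩ := hx.isNormalAt_nullVector hr hU hz
  have hg := Complex.normSq_pos.2 (hr.sub_ne_zero hz)
  obtain ⟨l, m, h1, h2, h3⟩ := null_pair_eq_smul (hx.det_nullVector_neg hr hU hz)
    (by simp [lorentz_nullVector]) (by simp [lorentz_nullVector])
    (by rw [lorentz_nullVector]; linarith) hN.1 hN.2 hN'.1 hN'.2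
    (hy.normal z hz).1 (hy.normal z hz).2 (hy.normal_star z hz).1 (hy.normal_star z hz).2
    (hy.null z hz) (hy.null_star z hz) (hy.pairing z hz) (hy.oriented z hz)
  have hl : y z 2 + y z 3 = l := by
    rw [h1, Pi.smul_apply, Pi.smul_apply, ← smul_add, nullVector_two_add_three, smul_eq_mul,
      mul_one]
  have hm : ystar z 2 + ystar z 3 = m := by
    rw [h2, Pi.smul_apply, Pi.smul_apply, ← smul_add, nullVector_two_add_three, smul_eq_mul,
      mul_one]
  rw [hl, hm]
  refine ⟨h1, h2, ?_⟩
  rw [lorentz_nullVector] at h3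
  linarith

theorem contDiffAt_nullVector {f : ℂ → ℂ} {z : ℂ} (hf : ContDiffAt ℝ ∞ f z) :
    ContDiffAt ℝ ∞ (fun w => nullVector (f w)) z := by
  have hre : ContDiffAt ℝ ∞ (fun w => (f w).re) z := Complex.reCLM.contDiff.contDiffAt.comp z hf
  have him : ContDiffAt ℝ ∞ (fun w => (f w).im) z := Complex.imCLM.contDiff.contDiffAt.comp z hf
  have hn : ContDiffAt ℝ ∞ (fun w => ‖f w‖ ^ 2) z := hf.norm_sq ℝ
  refine contDiffAt_pi.2 fun i => ?_
  fin_cases i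
  · exact hre
  · exact him
  · exact (contDiffAt_const.sub hn).div_const 2
  · exact (contDiffAt_const.add hn).div_const 2

theorem IsWeierstrassSurface.exists_isNullNormalFrame (hr : RegularityCondition φ ψ h U)
    (hx : IsWeierstrassSurface φ ψ h U x) (hU : IsOpen U) :
    ∃ y ystar : ℂ → Fin 4 → ℝ, IsNullNormalFrame x U y ystar := by
  have hψc : ∀ z ∈ U, ContDiffAt ℝ ∞ (fun w => conj (ψ w)) z := fun z hz =>
    (Complex.conjCLE : ℂ →L[ℝ] ℂ).contDiff.contDiffAt.comp z (contDiffAt_of_isOpen hU hr.1.2.1 hz)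
  have lin : ∀ (r : ℝ) (v w : Fin 4 → ℝ), lorentz (r • v) w = r * lorentz v w := by
    intro r v w; simp [lorentz]; ring
  refine ⟨fun z => nullVector (φ z),
    fun z => (-2 / ‖φ z - conj (ψ z)‖ ^ 2) • nullVector (conj (ψ z)), ?_⟩
  refine ⟨fun z hz => ?_, fun z hz => ?_, fun z hz => ?_, fun z hz => ?_, fun z hz => ?_,
    fun z hz => ?_, fun z hz => ?_, fun z hz => ?_⟩
  · exact (contDiffAt_nullVector (contDiffAt_of_isOpen hU hr.1.1 hz)).contDiffWithinAt
  · have hg : ContDiffAt ℝ ∞ (fun w => ‖φ w - conj (ψ w)‖ ^ 2) z :=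
      ((contDiffAt_of_isOpen hU hr.1.1 hz).sub (hψc z hz)).norm_sq ℝ
    have hg0 : ‖φ z - conj (ψ z)‖ ^ 2 ≠ 0 := by simpa using hr.sub_ne_zero hz
    exact ((contDiffAt_const.div hg hg0).smul (contDiffAt_nullVector (hψc z hz))).contDiffWithinAt
  · exact (hx.isNormalAt_nullVector hr hU hz).1
  · have := (hx.isNormalAt_nullVector hr hU hz).2
    exact ⟨by rw [lin, this.1, mul_zero], by rw [lin, this.2, mul_zero]⟩
  · simp [lorentz_nullVector]
  · rw [lin, lorentz_comm, lin]; simp [lorentz_nullVector]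
  · have hg0 : Complex.normSq (φ z - conj (ψ z)) ≠ 0 := by simpa using hr.sub_ne_zero hz
    rw [lorentz_comm, lin, lorentz_comm, lorentz_nullVector, ← Complex.normSq_eq_norm_sq]
    field_simp
  · have hg0 : 0 < Complex.normSq (φ z - conj (ψ z)) :=
      Complex.normSq_pos.2 (hr.sub_ne_zero hz)
    have h1 : ∀ (a b c d : Fin 4 → ℝ) (r : ℝ), (Matrix.of ![a, b, c, r • d]).det =
        r * (Matrix.of ![a, b, c, d]).det := by
      intro a b c d r; simp only [det_four, Pi.smul_apply, smul_eq_mul]; ring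
    rw [h1, ← Complex.normSq_eq_norm_sq]
    exact mul_pos_of_neg_of_neg (div_neg_of_neg_of_pos (by norm_num) hg0)
      (hx.det_nullVector_neg hr hU hz)

theorem HasPartials.nullVector {f : ℂ → ℂ} {fu fv : ℂ} {z : ℂ} (hf : HasPartials f fu fv z) :
    HasPartials (fun w => nullVector (f w))
      ![fu.re, fu.im, -(fu * conj (f z)).re, (fu * conj (f z)).re]
      ![fv.re, fv.im, -(fv * conj (f z)).re, (fv * conj (f z)).re] z := by
  have hre := hf.re
  have him := hf.clm_comp Complex.imCLM
  have hn := (hf.mul hf.conj).re.clm_comp ((1 / 2 : ℝ) • ContinuousLinearMap.id ℝ ℝ)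
  have h12 := hasPartials_of_differentiableAt (differentiableAt_const (1 / 2 : ℝ)) (z := z)
  have h2 := h12.sub hn
  have h3 := h12.add hn
  have key : ∀ i, HasFDerivAt (fun w => StationarySurface.nullVector (f w) i)
      (Complex.reCLM.smulRight
        (![fu.re, fu.im, -(fu * conj (f z)).re, (fu * conj (f z)).re] i) +
        Complex.imCLM.smulRight
        (![fv.re, fv.im, -(fv * conj (f z)).re, (fv * conj (f z)).re] i)) z := by
    intro i
    fin_cases i
    · exact hre
    · exact him
    · refine h2.congr (.of_forall fun w => ?_) ?_ ?_
      · simp [StationarySurface.nullVector, Complex.mul_conj, ← Complex.normSq_eq_norm_sq]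
        ring
      · simp [du]; ring
      · simp [dv]; ring
    · refine h3.congr (.of_forall fun w => ?_) ?_ ?_
      · simp [StationarySurface.nullVector, Complex.mul_conj, ← Complex.normSq_eq_norm_sq]
        ring
      · simp [du]; ring
      · simp [dv]; ring
  refine (hasFDerivAt_pi.2 key).congr_fderiv (ContinuousLinearMap.ext fun a => ?_)
  ext i
  fin_cases i <;> simp

/-- The connection form of the normal bundle in the frame `y = λ N(φ)`, `y* = μ N(ψ̄)` is
`d log λ + 2 Re (φ_z dz / (φ - ψ̄))`. -/
theorem lorentz_smul_nullVector_add {c d c' : ℂ} {l m l' : ℝ}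
    (hlm : l * m * Complex.normSq (c - d) = -2) (hcd : c - d ≠ 0) :
    lorentz (l • ![c'.re, c'.im, -(c' * conj c).re, (c' * conj c).re] + l' • nullVector c)
      (m • nullVector d) = l⁻¹ * l' + 2 * (c' / (c - d)).re := by
  have hn : Complex.normSq (c - d) ≠ 0 := by simpa using hcd
  have hl : l ≠ 0 := by rintro rfl; norm_num at hlm
  have hm : m = -2 / (l * Complex.normSq (c - d)) := by
    field_simp
    linarith
  have h1 : lorentz (l • ![c'.re, c'.im, -(c' * conj c).re, (c' * conj c).re] + l' • nullVector c)
      (m • nullVector d) = l * m * -(c' * conj (c - d)).re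
        + l' * m * lorentz (nullVector c) (nullVector d) := by
    simp [lorentz, nullVector, ← Complex.normSq_eq_norm_sq, Complex.normSq_apply]
    ring
  have h2 : (c' / (c - d)).re = (c' * conj (c - d)).re / Complex.normSq (c - d) := by
    rw [Complex.div_re]
    simp
    ring
  rw [h1, h2, lorentz_nullVector, hm]
  field_simp
  ring

/-- `K^⊥ dM = 4 Im (φ_z ψ̄_z̄ / (φ - ψ̄)²) du dv`: the exact part `d log λ` of the connection form
does not contribute. -/
theorem IsWeierstrassSurface.normalCurvature_mul (hr : RegularityCondition φ ψ h U)
    (hx : IsWeierstrassSurface φ ψ h U x) (hU : IsOpen U) {y ystar : ℂ → Fin 4 → ℝ}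
    (hy : IsNullNormalFrame x U y ystar) {z : ℂ} (hz : z ∈ U) :
    conformalFactor φ ψ h z * normalCurvature x y ystar z = 4 * (curvatureDensity φ ψ z).im := by
  obtain ⟨⟨hφ, hψ, hh⟩, -, -⟩ := id hr
  have hyc : ∀ w ∈ U, ContDiffAt ℝ ∞ (fun w => y w 2 + y w 3) w := fun w hw => by
    have := contDiffAt_pi.1 (hy.smooth.contDiffAt (hU.mem_nhds hw))
    exact (this 2).add (this 3)
  have hl0 : ∀ w ∈ U, y w 2 + y w 3 ≠ 0 := fun w hw h0 => by
    have := (hx.frame_eq_smul hr hU hy hw).2.2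
    rw [h0] at this
    norm_num at this
  have hlog : ∀ w ∈ U, ContDiffAt ℝ ∞ (fun w => Real.log (y w 2 + y w 3)) w := fun w hw =>
    (hyc w hw).log (hl0 w hw)
  have hconn : ∀ w ∈ U,
      lorentz (du y w) (ystar w) = du (fun w => Real.log (y w 2 + y w 3)) w
        + 2 * (deriv φ w / (φ w - conj (ψ w))).re ∧
      lorentz (dv y w) (ystar w) = dv (fun w => Real.log (y w 2 + y w 3)) w
        + 2 * (Complex.I * deriv φ w / (φ w - conj (ψ w))).re := by
    intro w hw
    obtain ⟨-, h2, h3⟩ := hx.frame_eq_smul hr hU hy hw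
    have hl := hasPartials_of_differentiableAt
      ((hyc w hw).differentiableAt (by simp : (∞ : WithTop ℕ∞) ≠ 0))
    have hN := (hasPartials_of_hasDerivAt (hasDerivAt_of_isOpen hU hφ hw)).nullVector
    have hyP : HasPartials y _ _ w := (hl.smul hN).congr (g := y) (by
      filter_upwards [hU.mem_nhds hw] with w' hw' using (hx.frame_eq_smul hr hU hy hw').1) rfl rfl
    have hlogP := HasPartials.real_comp (f := fun w => y w 2 + y w 3)
      (Real.hasDerivAt_log (hl0 w hw)) hl
    have hg0 := hr.sub_ne_zero hw
    rw [hyP.du_eq, hyP.dv_eq, hlogP.du_eq, hlogP.dv_eq, h2]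
    exact ⟨lorentz_smul_nullVector_add h3 hg0, lorentz_smul_nullVector_add h3 hg0⟩
  have hC2 : ContDiffAt ℝ 2 (fun w => Real.log (y w 2 + y w 3)) z :=
    contDiffAt_infty.1 (hlog z hz) 2
  have hd : DifferentiableAt ℝ (fderiv ℝ fun w => Real.log (y w 2 + y w 3)) z :=
    (hC2.fderiv_right (m := 1) (by norm_num)).differentiableAt one_ne_zero
  have hdu : DifferentiableAt ℝ (du fun w => Real.log (y w 2 + y w 3)) z :=
    hd.clm_apply (differentiableAt_const _)
  have hdv : DifferentiableAt ℝ (dv fun w => Real.log (y w 2 + y w 3)) z :=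
    hd.clm_apply (differentiableAt_const _)
  have hφ2 := hasPartials_of_hasDerivAt (hasDerivAt_of_isOpen hU (hφ.deriv hU) hz)
  have hI := hasPartials_of_hasDerivAt (hasDerivAt_const z Complex.I)
  have hg := hasPartials_sub_conj hU hφ hψ hz
  have hg0 := hr.sub_ne_zero hz
  have h1 := ((hasPartials_of_differentiableAt hdu).add ((hφ2.div hg hg0).re.clm_comp
    ((2 : ℝ) • ContinuousLinearMap.id ℝ ℝ))).congr (g := fun w => lorentz (du y w) (ystar w)) (by
      filter_upwards [hU.mem_nhds hz] with w hw using (hconn w hw).1) rfl rfl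
  have h2 := ((hasPartials_of_differentiableAt hdv).add (((hI.mul hφ2).div hg hg0).re.clm_comp
    ((2 : ℝ) • ContinuousLinearMap.id ℝ ℝ))).congr (g := fun w => lorentz (dv y w) (ystar w)) (by
      filter_upwards [hU.mem_nhds hz] with w hw using (hconn w hw).2) rfl rfl
  rw [normalCurvature, h1.dv_eq, h2.du_eq, dv_du_eq_du_dv hC2, hx.areaDensity_eq hr hU hz,
    mul_div_cancel₀ _ (hr.conformalFactor_pos hz).ne']
  have him : ∀ w : ℂ, w.im = (-Complex.I * w).re := by intro w; simp
  rw [him, curvatureDensity, add_sub_add_left_eq_sub]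
  simp only [smul_apply, ContinuousLinearMap.id_apply, smul_eq_mul]
  rw [← mul_sub, ← Complex.sub_re]
  have e : (Complex.I * deriv (deriv φ) z / (φ z - conj (ψ z)) -
      deriv φ z * (Complex.I * (deriv φ z + conj (deriv ψ z))) / (φ z - conj (ψ z)) ^ 2 -
      ((Complex.I * deriv (deriv φ) z + deriv φ z * 0) / (φ z - conj (ψ z)) -
      Complex.I * deriv φ z * (deriv φ z - conj (deriv ψ z)) / (φ z - conj (ψ z)) ^ 2)) =
      (2 : ℝ) * (-Complex.I * (deriv φ z * conj (deriv ψ z) / (φ z - conj (ψ z)) ^ 2)) := by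
    push_cast
    ring
  rw [e, Complex.re_ofReal_mul]
  ring

end Curvature

/-! ### Total curvature as a planar integral -/

section TotalCurvature

variable {φ ψ h : ℂ → ℂ} {U : Set ℂ} {x : ℂ → Fin 4 → ℝ}

theorem IsWeierstrassSurface.areaMeasure_eq (hr : RegularityCondition φ ψ h U)
    (hx : IsWeierstrassSurface φ ψ h U x) (hU : IsOpen U) :
    areaMeasure x U =
      (volume.restrict U).withDensity fun z => ENNReal.ofReal (conformalFactor φ ψ h z) := by
  refine withDensity_congr_ae ?_
  filter_upwards [self_mem_ae_restrict hU.measurableSet] with z hz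
  rw [hx.areaDensity_eq hr hU hz]

theorem aemeasurable_conformalFactor (hr : RegularityCondition φ ψ h U) (hU : IsOpen U) :
    AEMeasurable (fun z => ENNReal.ofReal (conformalFactor φ ψ h z)) (volume.restrict U) := by
  refine ENNReal.measurable_ofReal.comp_aemeasurable (ContinuousOn.aemeasurable
    (fun z hz => ?_) hU.measurableSet)
  exact (contDiffAt_conformalFactor hr hU hz).continuousAt.continuousWithinAt

theorem IsWeierstrassSurface.integrable_areaMeasure_iff {E : Type*} [NormedAddCommGroup E]
    [NormedSpace ℝ E] (hr : RegularityCondition φ ψ h U)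
    (hx : IsWeierstrassSurface φ ψ h U x) (hU : IsOpen U) {f g : ℂ → E}
    (hfg : ∀ z ∈ U, conformalFactor φ ψ h z • f z = g z) :
    Integrable f (areaMeasure x U) ↔ IntegrableOn g U := by
  rw [hx.areaMeasure_eq hr hU, integrable_withDensity_iff_integrable_smul₀'
    (aemeasurable_conformalFactor hr hU) (.of_forall fun _ => ENNReal.ofReal_lt_top)]
  refine integrable_congr ?_
  filter_upwards [self_mem_ae_restrict hU.measurableSet] with z hz
  rw [ENNReal.toReal_ofReal (hr.conformalFactor_pos hz).le, hfg z hz]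

theorem IsWeierstrassSurface.integral_areaMeasure_eq {E : Type*} [NormedAddCommGroup E]
    [NormedSpace ℝ E] (hr : RegularityCondition φ ψ h U)
    (hx : IsWeierstrassSurface φ ψ h U x) (hU : IsOpen U) {f g : ℂ → E}
    (hfg : ∀ z ∈ U, conformalFactor φ ψ h z • f z = g z) :
    ∫ z, f z ∂(areaMeasure x U) = ∫ z in U, g z := by
  rw [hx.areaMeasure_eq hr hU, integral_withDensity_eq_integral_toReal_smul₀
    (aemeasurable_conformalFactor hr hU) (.of_forall fun _ => ENNReal.ofReal_lt_top)]
  refine integral_congr_ae ?_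
  filter_upwards [self_mem_ae_restrict hU.measurableSet] with z hz
  rw [ENNReal.toReal_ofReal (hr.conformalFactor_pos hz).le, hfg z hz]

end TotalCurvature

/-! ### Completeness of metrics on the punctured plane -/

theorem isOpen_puncturedPlane : IsOpen puncturedPlane := isOpen_compl_singleton

theorem inducedDist_le_of_segment {x : ℂ → Fin 4 → ℝ} {U : Set ℂ} {p q : ℂ} {C : ℝ}
    (hseg : segment ℝ p q ⊆ U)
    (hC : ∀ z ∈ segment ℝ p q, ∀ a : ℂ, Real.sqrt (firstForm x z a a) ≤ C * ‖a‖) :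
    inducedDist x U p q ≤ ENNReal.ofReal (C * ‖q - p‖) := by
  have hγ := isPathIn_segment (Subset.refl (segment ℝ p q))
  refine (iInf₂_le (fun t : ℝ => p + t * (q - p))
    ⟨hγ.mono hseg, by simp, by simp⟩).trans ?_
  have hd : ∀ t : ℝ, deriv (fun t : ℝ => p + t * (q - p)) t = q - p := by
    intro t
    have : HasDerivAt (fun t : ℝ => p + t * (q - p)) (1 * (q - p)) t :=
      (((hasDerivAt_id t).ofReal_comp).mul_const (q - p)).const_add p
    simpa using this.deriv
  calc inducedLength x (fun t : ℝ => p + t * (q - p))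
      ≤ ∫⁻ _ in Icc (0 : ℝ) 1, ENNReal.ofReal (C * ‖q - p‖) := by
        refine setLIntegral_mono' measurableSet_Icc fun t ht => ?_
        rw [hd]
        exact ENNReal.ofReal_le_ofReal (hC _ (hγ.2.1 ht) _)
    _ = ENNReal.ofReal (C * ‖q - p‖) := by simp

/-- A metric on `ℂ \ {0}` is complete if it dominates multiples of `|dz|` and of
`|dz| / |z|² = |d(1/z)|`: along Cauchy sequences both `z` and `1/z` converge. -/
theorem isCompleteSurface_of_le {x : ℂ → Fin 4 → ℝ} {c : ℝ} (hc : 0 < c) {f : ℂ → ℝ}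
    (hf : ContinuousOn f puncturedPlane)
    (hx : ∀ z ∈ puncturedPlane, ∀ a : ℂ, Real.sqrt (firstForm x z a a) = f z * ‖a‖)
    (h1 : ∀ z ∈ puncturedPlane, c ≤ f z) (h2 : ∀ z ∈ puncturedPlane, c / ‖z‖ ^ 2 ≤ f z) :
    IsCompleteSurface x puncturedPlane := by
  intro s hs hcauchy
  have hF1 : ∀ p q, edist ((c : ℂ) * q) (c * p) ≤ inducedDist x puncturedPlane p q := by
    refine edist_le_inducedDist (F := fun z => c * z) (f := fun _ => (c : ℂ))
      (fun z _ => by simpa using (hasDerivAt_id z).const_mul (c : ℂ)) continuousOn_const ?_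
    intro z hz a
    rw [hx z hz a, norm_mul, Complex.norm_real, Real.norm_of_nonneg hc.le]
    gcongr
    exact h1 z hz
  have hF2 : ∀ p q, edist ((c : ℂ) * q⁻¹) (c * p⁻¹) ≤ inducedDist x puncturedPlane p q := by
    refine edist_le_inducedDist (F := fun z => c * z⁻¹) (f := fun z => (c : ℂ) * -(z ^ 2)⁻¹)
      (fun z hz => (hasDerivAt_inv hz).const_mul (c : ℂ)) ?_ ?_
    · refine continuousOn_const.mul (ContinuousOn.neg (ContinuousOn.inv₀ (by fun_prop) ?_))
      intro z hz
      exact pow_ne_zero 2 hz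
    intro z hz a
    rw [hx z hz a, norm_mul, norm_mul, Complex.norm_real, Real.norm_of_nonneg hc.le, norm_neg,
      norm_inv, norm_pow, ← div_eq_mul_inv]
    gcongr
    exact h2 z hz
  have hlim : ∀ F : ℂ → ℂ, (∀ p q, edist (F q) (F p) ≤ inducedDist x puncturedPlane p q) →
      ∃ l, Tendsto (fun n => F (s n)) atTop (𝓝 l) := by
    intro F hF
    refine cauchySeq_tendsto_of_complete (EMetric.cauchySeq_iff.2 fun ε hε => ?_)
    obtain ⟨N, hN⟩ := hcauchy ε hε
    exact ⟨N, fun m hm n hn => (hF (s n) (s m)).trans_lt (hN n m hn hm)⟩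
  obtain ⟨l, hl⟩ := hlim _ hF1
  obtain ⟨l', hl'⟩ := hlim _ hF2
  have hc0 : (c : ℂ) ≠ 0 := by exact_mod_cast hc.ne'
  have hl0 : l ≠ 0 := by
    rintro rfl
    have h3 := hl.mul hl'
    rw [zero_mul] at h3
    have h4 : (fun n => (c : ℂ) * s n * (c * (s n)⁻¹)) = fun _ => (c : ℂ) * c := by
      funext n
      have : s n ≠ 0 := hs n
      field_simp
    rw [h4] at h3
    exact mul_ne_zero hc0 hc0 (tendsto_nhds_unique tendsto_const_nhds h3)
  set p : ℂ := l / c with hp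
  have hp0 : p ∈ puncturedPlane := div_ne_zero hl0 hc0
  have hsp : Tendsto s atTop (𝓝 p) := by
    have := hl.div_const (c : ℂ)
    simpa [mul_div_cancel_left₀ _ hc0] using this
  refine ⟨p, hp0, ?_⟩
  -- on a small ball the induced distance is bounded by a multiple of the Euclidean one
  have hfp : ContinuousAt f p := hf.continuousAt (isOpen_puncturedPlane.mem_nhds hp0)
  obtain ⟨r, hr0, hr⟩ := Metric.eventually_nhds_iff_ball.1
    ((hfp.eventually (gt_mem_nhds (lt_add_one (f p)))).and
      (isOpen_puncturedPlane.mem_nhds hp0))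
  have hlim0 : Tendsto (fun n => ENNReal.ofReal ((f p + 1) * ‖p - s n‖)) atTop (𝓝 0) := by
    have h5 : Tendsto (fun n => (f p + 1) * ‖p - s n‖) atTop (𝓝 0) := by
      have := ((tendsto_const_nhds (x := p)).sub hsp).norm.const_mul (f p + 1)
      simpa using this
    simpa using ENNReal.tendsto_ofReal h5
  refine tendsto_of_tendsto_of_tendsto_of_le_of_le' tendsto_const_nhds hlim0
    (.of_forall fun _ => zero_le) ?_
  filter_upwards [hsp.eventually (Metric.ball_mem_nhds p hr0)] with n hn
  have hseg : segment ℝ (s n) p ⊆ Metric.ball p r :=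
    (convex_ball p r).segment_subset hn (Metric.mem_ball_self hr0)
  refine inducedDist_le_of_segment (fun z hz => (hr z (hseg hz)).2) fun z hz a => ?_
  rw [hx z (hr z (hseg hz)).2]
  gcongr
  exact (hr z (hseg hz)).1.le

/-! ### Essential singularities at infinity -/

/-- A function that grows along the positive real axis faster than every power has no meromorphic
extension to `∞`. -/
theorem not_meromorphicAt_comp_inv {f : ℂ → ℂ}
    (hf : ∀ n : ℕ, Tendsto (fun t : ℝ => ‖f t‖ / t ^ n) atTop atTop) :
    ¬ MeromorphicAt (fun w => f w⁻¹) 0 := by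
  rintro ⟨n, hn⟩
  have h1 : Tendsto (fun t : ℝ => ((t⁻¹ : ℝ) : ℂ)) atTop (𝓝 0) := by
    have := (Complex.continuous_ofReal.tendsto 0).comp tendsto_inv_atTop_zero
    simpa [Function.comp_def] using this
  have h2 := (hn.continuousAt.tendsto.comp h1).norm
  refine not_tendsto_atTop_of_tendsto_nhds h2 ((hf n).congr' ?_)
  filter_upwards [eventually_gt_atTop 0] with t ht
  simp [abs_of_pos ht, div_eq_inv_mul]

theorem hasEssentialSingularityAtInfty_phi (k : ℕ) {a : ℝ} (ha : 0 < a) :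
    HasEssentialSingularityAtInfty (phi k a) := by
  refine ⟨.of_forall fun z => ?_, not_meromorphicAt_comp_inv fun n => ?_⟩
  · have : Differentiable ℂ (phi k a) := by unfold phi; fun_prop
    exact this.analyticAt z
  · refine tendsto_atTop_mono' _ ?_ (tendsto_exp_mul_div_rpow_atTop n a ha)
    filter_upwards [eventually_ge_atTop 1] with t ht
    have h0 : (0 : ℝ) < t := by linarith
    rw [Real.rpow_natCast, phi, norm_mul, norm_pow, Complex.norm_real, Complex.norm_exp,
      Real.norm_of_nonneg h0.le]
    gcongr
    have : ((a : ℂ) * t).re = a * t := by simp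
    rw [this]
    exact le_mul_of_one_le_left (Real.exp_pos _).le (one_le_pow₀ ht)

theorem hasEssentialSingularityAtInfty_psi (k : ℕ) {a : ℝ} (ha : 0 < a) :
    HasEssentialSingularityAtInfty (psi k a) := by
  refine ⟨?_, not_meromorphicAt_comp_inv fun n => ?_⟩
  · filter_upwards [(isCompact_singleton (x := (0 : ℂ))).compl_mem_cocompact] with z hz
    have : DifferentiableOn ℂ (psi k a) {0}ᶜ := by
      unfold psi
      refine DifferentiableOn.div (by fun_prop) (by fun_prop) fun w hw => pow_ne_zero k hw
    exact this.analyticAt (isOpen_compl_singleton.mem_nhds hz)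
  · refine (tendsto_exp_mul_div_rpow_atTop ((k + n : ℕ) : ℝ) a ha).congr' ?_
    filter_upwards [eventually_gt_atTop 0] with t ht
    rw [Real.rpow_natCast, psi, norm_div, norm_neg, norm_pow, Complex.norm_real, Complex.norm_exp,
      Real.norm_of_nonneg ht.le, pow_add, ← div_div]
    simp

/-! ### The ends of the punctured plane -/

/-- The closed annulus `R⁻¹ ≤ |z| ≤ R`. -/
def annulus (R : ℝ) : Set ℂ := {z | R⁻¹ ≤ ‖z‖ ∧ ‖z‖ ≤ R}

/-- The two components of the complement of `annulus R` in the punctured plane: the punctured disc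
`0 < |z| < R⁻¹` for `false`, the exterior domain `|z| > R` for `true`. -/
def endTail (b : Bool) (R : ℝ) : Set ℂ := {z | ‖z‖ ∈ cond b (Ioi R) (Ioo 0 R⁻¹)}

theorem isPreconnected_setOf_norm_mem {I : Set ℝ} (hI : I.OrdConnected) (h0 : I ⊆ Ioi 0) :
    IsPreconnected {z : ℂ | ‖z‖ ∈ I} := by
  have : {z : ℂ | ‖z‖ ∈ I} =
      (fun q : ℝ × ℝ => (q.1 : ℂ) * Complex.exp (q.2 * Complex.I)) '' (I ×ˢ univ) := by
    ext z
    constructor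
    · intro hz
      exact ⟨(‖z‖, z.arg), ⟨hz, mem_univ _⟩, Complex.norm_mul_exp_arg_mul_I z⟩
    · rintro ⟨⟨r, t⟩, ⟨hr, -⟩, rfl⟩
      have : 0 < r := h0 hr
      simpa [Complex.norm_exp_ofReal_mul_I, abs_of_pos this] using hr
  rw [this]
  exact (hI.isPreconnected.prod isPreconnected_univ).image _ (by fun_prop)

theorem isPreconnected_endTail (b : Bool) {R : ℝ} (hR : 1 < R) :
    IsPreconnected (endTail b R) := by
  cases b
  · exact isPreconnected_setOf_norm_mem ordConnected_Ioo fun r hr => hr.1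
  · exact isPreconnected_setOf_norm_mem ordConnected_Ioi fun r hr =>
      (zero_lt_one.trans hR).trans hr

theorem isOpen_endTail (b : Bool) (R : ℝ) : IsOpen (endTail b R) := by
  cases b
  · exact isOpen_Ioo.preimage continuous_norm
  · exact isOpen_Ioi.preimage continuous_norm

theorem endTail_nonempty (b : Bool) {R : ℝ} (hR : 1 < R) : (endTail b R).Nonempty := by
  have h0 : 0 < R := by linarith
  have h1 : 0 < R⁻¹ := inv_pos.2 h0
  cases b
  · refine ⟨((R⁻¹ / 2 : ℝ) : ℂ), ?_⟩
    simp only [endTail, cond_false, mem_ofPred_eq, Complex.norm_real,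
      Real.norm_of_nonneg (half_pos h1).le]
    exact ⟨half_pos h1, half_lt_self h1⟩
  · refine ⟨((R + 1 : ℝ) : ℂ), ?_⟩
    simp only [endTail, cond_true, mem_ofPred_eq, Complex.norm_real,
      Real.norm_of_nonneg (by linarith : 0 ≤ R + 1)]
    exact lt_add_one R

theorem endTail_anti (b : Bool) {R S : ℝ} (hR : 1 < R) (hRS : R ≤ S) :
    endTail b S ⊆ endTail b R := by
  have h0 : 0 < R := by linarith
  cases b
  · exact fun z hz => ⟨hz.1, hz.2.trans_le (inv_anti₀ h0 hRS)⟩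
  · exact fun z hz => hRS.trans_lt hz

theorem disjoint_endTail {R : ℝ} (hR : 1 < R) : Disjoint (endTail false R) (endTail true R) :=
  Set.disjoint_left.2 fun z (h1 : ‖z‖ ∈ Ioo 0 R⁻¹) (h2 : ‖z‖ ∈ Ioi R) => by
    have := inv_lt_one_of_one_lt₀ hR
    have h3 := h1.2
    have h4 : R < ‖z‖ := h2
    linarith

theorem eq_of_mem_endTail {b c : Bool} {R : ℝ} (hR : 1 < R) {z : ℂ} (hb : z ∈ endTail b R)
    (hc : z ∈ endTail c R) : b = c := by
  have : z ∈ endTail false R → z ∉ endTail true R := fun h1 h2 =>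
    Set.disjoint_left.1 (disjoint_endTail hR) h1 h2
  cases b <;> cases c <;> simp_all

theorem compl_annulus {R : ℝ} (hR : 1 < R) :
    puncturedPlane \ annulus R = endTail false R ∪ endTail true R := by
  ext z
  have h0 : 0 < R := by linarith
  simp only [puncturedPlane, annulus, endTail, Set.mem_sdiff, mem_compl_iff, mem_singleton_iff,
    mem_ofPred_eq, not_and_or, not_le, cond_false, cond_true, mem_union, mem_Ioo, mem_Ioi,
    ← norm_pos_iff]
  constructor
  · rintro ⟨h1, h2 | h2⟩
    · exact .inl ⟨h1, h2⟩
    · exact .inr h2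
  · rintro (⟨h1, h2⟩ | h2)
    · exact ⟨h1, .inl h2⟩
    · exact ⟨h0.trans h2, .inr h2⟩

theorem endTail_subset_compl {K : Set ℂ} (b : Bool) {R : ℝ} (hR : 1 < R) (hK : K ⊆ annulus R) :
    endTail b R ⊆ puncturedPlane \ K := by
  refine Subset.trans ?_ (sdiff_subset_sdiff_right hK)
  rw [compl_annulus hR]
  cases b
  · exact subset_union_left
  · exact subset_union_right

theorem annulus_mono {R S : ℝ} (hR : 1 < R) (hRS : R ≤ S) : annulus R ⊆ annulus S :=
  fun _ hz => ⟨(inv_anti₀ (by linarith) hRS).trans hz.1, hz.2.trans hRS⟩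

theorem isCompact_annulus (R : ℝ) : IsCompact (annulus R) := by
  have : annulus R = Metric.closedBall 0 R ∩ {z | R⁻¹ ≤ ‖z‖} := by
    ext z
    simp [annulus, and_comm]
  rw [this]
  exact (isCompact_closedBall 0 R).inter_right (isClosed_le continuous_const continuous_norm)

theorem annulus_subset {R : ℝ} (hR : 1 < R) : annulus R ⊆ puncturedPlane := by
  intro z hz
  have : 0 < R⁻¹ := inv_pos.2 (by linarith)
  exact norm_pos_iff.1 (this.trans_le hz.1)

theorem exists_subset_annulus {K : Set ℂ} (hK : IsCompact K) (hKU : K ⊆ puncturedPlane) :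
    ∃ R, 2 ≤ R ∧ K ⊆ annulus R := by
  obtain ⟨C, hC⟩ := hK.isBounded.exists_norm_le
  obtain ⟨D, hD⟩ := (hK.image_of_continuousOn (f := fun z : ℂ => z⁻¹)
    (continuousOn_inv₀.mono hKU)).isBounded.exists_norm_le
  refine ⟨max 2 (max C D), le_max_left _ _, fun z hz => ⟨?_, ?_⟩⟩
  · have h1 := hD _ (mem_image_of_mem _ hz)
    rw [norm_inv] at h1
    have h2 : 0 < ‖z‖ := norm_pos_iff.2 (hKU hz)
    exact inv_le_of_inv_le₀ h2 (h1.trans ((le_max_right _ _).trans (le_max_right _ _)))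
  · exact (hC z hz).trans ((le_max_left _ _).trans (le_max_right _ _))

theorem connectedComponentIn_compl_annulus {b : Bool} {R : ℝ} (hR : 1 < R) {p : ℂ}
    (hp : p ∈ endTail b R) :
    connectedComponentIn (puncturedPlane \ annulus R) p = endTail b R := by
  refine Subset.antisymm ?_ ((isPreconnected_endTail b hR).subset_connectedComponentIn hp
    (endTail_subset_compl b hR Subset.rfl))
  have hpc := isPreconnected_connectedComponentIn (x := p) (F := puncturedPlane \ annulus R)
  have hsub := connectedComponentIn_subset (puncturedPlane \ annulus R) p
  have hmem := mem_connectedComponentIn (endTail_subset_compl b hR Subset.rfl hp)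
  rw [compl_annulus hR] at hpc hsub hmem ⊢
  cases b
  · exact hpc.subset_left_of_subset_union (isOpen_endTail _ R) (isOpen_endTail _ R)
      (disjoint_endTail hR) hsub ⟨p, hmem, hp⟩
  · exact hpc.subset_right_of_subset_union (isOpen_endTail _ R) (isOpen_endTail _ R)
      (disjoint_endTail hR) hsub ⟨p, hmem, hp⟩

/-- The component of `ℂ \ ({0} ∪ K)` that contains the tails `endTail b R` for large `R`. -/
def endComponent (b : Bool) (K : Set ℂ) : Set ℂ :=
  {z | ∃ R, 1 < R ∧ K ⊆ annulus R ∧ ∃ p ∈ endTail b R,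
    z ∈ connectedComponentIn (puncturedPlane \ K) p}

theorem endComponent_eq {b : Bool} {K : Set ℂ} {R : ℝ} (hR : 1 < R) (hK : K ⊆ annulus R) {p : ℂ}
    (hp : p ∈ endTail b R) :
    endComponent b K = connectedComponentIn (puncturedPlane \ K) p := by
  refine Subset.antisymm ?_ fun z hz => ⟨R, hR, hK, p, hp, hz⟩
  rintro z ⟨S, hS, hKS, q, hq, hz⟩
  -- the tails are nested, so that both base points lie in the larger one
  have key : ∀ T, 1 < T → K ⊆ annulus T → p ∈ endTail b T → q ∈ endTail b T →
      connectedComponentIn (puncturedPlane \ K) q = connectedComponentIn (puncturedPlane \ K) p :=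
    fun T hT hKT hpT hqT => connectedComponentIn_eq
      ((isPreconnected_endTail b hT).subset_connectedComponentIn hqT
        (endTail_subset_compl b hT hKT) hpT)
  rcases le_total R S with h | h
  · rwa [← key R hR hK hp (endTail_anti b hR h hq)]
  · rwa [← key S hS hKS (endTail_anti b hS h hp) hq]

theorem endTail_subset_endComponent {b : Bool} {K : Set ℂ} {R : ℝ} (hR : 1 < R)
    (hK : K ⊆ annulus R) : endTail b R ⊆ endComponent b K := fun p hp => by
  rw [endComponent_eq hR hK hp]
  exact mem_connectedComponentIn (endTail_subset_compl b hR hK hp)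

theorem isEnd_endComponent (b : Bool) : IsEnd puncturedPlane fun K => endComponent b K.1 := by
  refine ⟨fun K => ?_, fun K L hKL => ?_⟩
  · obtain ⟨R, hR, hK⟩ := exists_subset_annulus K.2.1 K.2.2
    obtain ⟨p, hp⟩ := endTail_nonempty b (by linarith : 1 < R)
    exact ⟨p, endTail_subset_compl b (by linarith) hK hp, endComponent_eq (by linarith) hK hp⟩
  · obtain ⟨R, hR, hL⟩ := exists_subset_annulus L.2.1 L.2.2
    obtain ⟨p, hp⟩ := endTail_nonempty b (by linarith : 1 < R)
    simp only
    rw [endComponent_eq (by linarith) hL hp, endComponent_eq (by linarith) (hKL.trans hL) hp]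
    exact connectedComponentIn_mono p (sdiff_subset_sdiff_right hKL)

theorem IsEnd.exists_eq_endComponent {e : {K : Set ℂ // IsCompact K ∧ K ⊆ puncturedPlane} → Set ℂ}
    (he : IsEnd puncturedPlane e) : ∃ b, e = fun K => endComponent b K.1 := by
  have hA : ∀ R (hR : 1 < R), ∃ b,
      e ⟨annulus R, isCompact_annulus R, annulus_subset hR⟩ = endTail b R := by
    intro R hR
    obtain ⟨p, hp, hep⟩ := he.1 ⟨annulus R, isCompact_annulus R, annulus_subset hR⟩
    rw [hep]
    simp only at hp ⊢
    have hp' := hp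
    rw [compl_annulus hR] at hp'
    rcases hp' with hp' | hp'
    · exact ⟨false, connectedComponentIn_compl_annulus hR hp'⟩
    · exact ⟨true, connectedComponentIn_compl_annulus hR hp'⟩
  obtain ⟨b, hb⟩ := hA 2 one_lt_two
  refine ⟨b, funext fun K => ?_⟩
  obtain ⟨R, hR2, hK⟩ := exists_subset_annulus K.2.1 K.2.2
  have hR : 1 < R := by linarith
  obtain ⟨c, hc⟩ := hA R hR
  obtain ⟨p, hp⟩ := endTail_nonempty c hR
  have hcb : c = b := by
    have h1 := he.2 ⟨annulus 2, isCompact_annulus 2, annulus_subset one_lt_two⟩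
      ⟨annulus R, isCompact_annulus R, annulus_subset hR⟩ (annulus_mono one_lt_two hR2)
    rw [hb, hc] at h1
    exact eq_of_mem_endTail one_lt_two (endTail_anti c one_lt_two hR2 hp) (h1 hp)
  subst hcb
  have h2 := he.2 K ⟨annulus R, isCompact_annulus R, annulus_subset hR⟩ hK
  rw [hc] at h2
  obtain ⟨q, -, hq⟩ := he.1 K
  have hpq := h2 hp
  rw [hq] at hpq ⊢
  rw [endComponent_eq hR hK hp, connectedComponentIn_eq hpq]

theorem hasTwoEndsZeroInfty_puncturedPlane : HasTwoEndsZeroInfty puncturedPlane := by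
  refine ⟨fun K => endComponent false K.1, fun K => endComponent true K.1, fun h => ?_,
    fun e => ⟨fun he => ?_, ?_⟩, fun K => ?_, fun K => ?_⟩
  · have h1 := congrFun h ⟨annulus 2, isCompact_annulus 2, annulus_subset one_lt_two⟩
    obtain ⟨p, hp⟩ := endTail_nonempty false one_lt_two
    obtain ⟨q, hq⟩ := endTail_nonempty true one_lt_two
    simp only at h1
    rw [endComponent_eq one_lt_two Subset.rfl hp, endComponent_eq one_lt_two Subset.rfl hq,
      connectedComponentIn_compl_annulus one_lt_two hp,
      connectedComponentIn_compl_annulus one_lt_two hq] at h1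
    exact Set.disjoint_left.1 (disjoint_endTail one_lt_two) hp (h1 ▸ hp)
  · obtain ⟨b, rfl⟩ := he.exists_eq_endComponent
    cases b
    · exact .inl rfl
    · exact .inr rfl
  · rintro (rfl | rfl)
    · exact isEnd_endComponent false
    · exact isEnd_endComponent true
  · obtain ⟨R, hR, hK⟩ := exists_subset_annulus K.2.1 K.2.2
    refine mem_of_superset ?_ (endTail_subset_endComponent (by linarith : 1 < R) hK)
    have hR0 : 0 < R⁻¹ := inv_pos.2 (by linarith)
    filter_upwards [self_mem_nhdsWithin, mem_nhdsWithin_of_mem_nhds (Metric.ball_mem_nhds 0 hR0)]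
      with z hz hz'
    exact ⟨norm_pos_iff.2 hz, by simpa using hz'⟩
  · obtain ⟨R, hR, hK⟩ := exists_subset_annulus K.2.1 K.2.2
    refine mem_of_superset ?_ (endTail_subset_endComponent (by linarith : 1 < R) hK)
    filter_upwards [(isCompact_closedBall (0 : ℂ) R).compl_mem_cocompact] with z hz
    simpa [endTail] using hz

/-! ### Data with globally defined primitives -/

section Exact

variable {φ ψ h : ℂ → ℂ} {U : Set ℂ}

theorem periodCondition_of_exact (hr : RegularityCondition φ ψ h U) {A B C D : ℂ → ℂ}
    (hA : ∀ z ∈ U, HasDerivAt A (φ z * h z) z) (hB : ∀ z ∈ U, HasDerivAt B (ψ z * h z) z)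
    (hC : ∀ z ∈ U, HasDerivAt C (h z) z) (hD : ∀ z ∈ U, HasDerivAt D (φ z * ψ z * h z) z) :
    PeriodCondition φ ψ h U := by
  obtain ⟨⟨h1, h2, h3⟩, -, -⟩ := hr
  intro γ hγ hcl
  rw [hγ.lineIntegral_eq_sub hA (h1.mul h3).continuousOn,
    hγ.lineIntegral_eq_sub hB (h2.mul h3).continuousOn,
    hγ.lineIntegral_eq_sub hC h3.continuousOn,
    hγ.lineIntegral_eq_sub hD ((h1.mul h2).mul h3).continuousOn, hcl]
  simp

theorem exists_isWeierstrassSurface_of_exact (hr : RegularityCondition φ ψ h U)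
    {A B C D : ℂ → ℂ}
    (hA : ∀ z ∈ U, HasDerivAt A (φ z * h z) z) (hB : ∀ z ∈ U, HasDerivAt B (ψ z * h z) z)
    (hC : ∀ z ∈ U, HasDerivAt C (h z) z) (hD : ∀ z ∈ U, HasDerivAt D (φ z * ψ z * h z) z) :
    ∃ x : ℂ → Fin 4 → ℝ, IsWeierstrassSurface φ ψ h U x := by
  have hF : ∀ i, ∃ F : ℂ → ℂ, ∀ z ∈ U, HasDerivAt F (weierstrassForm φ ψ h i z) z := by
    intro i
    fin_cases i
    · refine ⟨fun z => A z + B z, fun z hz => ((hA z hz).add (hB z hz)).congr_deriv ?_⟩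
      simp [weierstrassForm]; ring
    · refine ⟨fun z => -Complex.I * (A z - B z),
        fun z hz => (((hA z hz).sub (hB z hz)).const_mul (-Complex.I)).congr_deriv ?_⟩
      simp [weierstrassForm]; ring
    · refine ⟨fun z => C z - D z, fun z hz => ((hC z hz).sub (hD z hz)).congr_deriv ?_⟩
      simp [weierstrassForm]; ring
    · refine ⟨fun z => C z + D z, fun z hz => ((hC z hz).add (hD z hz)).congr_deriv ?_⟩
      simp [weierstrassForm]; ring
  choose F hF using hF
  refine ⟨fun z i => 2 * (F i z).re, fun γ hγ i => ?_⟩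
  rw [hγ.lineIntegral_eq_sub (hF i) (hr.differentiableOn_weierstrassForm i).continuousOn,
    Complex.sub_re]
  ring

end Exact

/-! ### The Weierstrass data of the examples -/

theorem hasDerivAt_exp_mul (a z : ℂ) :
    HasDerivAt (fun w => Complex.exp (a * w)) (a * Complex.exp (a * z)) z :=
  (((hasDerivAt_id z).const_mul a).cexp).congr_deriv (by simp; ring)

theorem hasDerivAt_phi (k : ℕ) (a : ℝ) {z : ℂ} (hz : z ≠ 0) :
    HasDerivAt (phi k a) ((k / z + a) * phi k a z) z := by
  refine ((hasDerivAt_pow k z).mul (hasDerivAt_exp_mul a z)).congr_deriv ?_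
  cases k with
  | zero => simp [phi]
  | succ m =>
    simp only [phi, Nat.add_sub_cancel]
    field_simp
    ring

theorem hasDerivAt_psi (k : ℕ) (a : ℝ) {z : ℂ} (hz : z ≠ 0) :
    HasDerivAt (psi k a) ((a - k / z) * psi k a z) z := by
  refine ((hasDerivAt_exp_mul a z).neg.div (hasDerivAt_pow k z) (pow_ne_zero k hz)).congr_deriv ?_
  cases k with
  | zero => simp [psi]
  | succ m =>
    simp only [psi, Nat.add_sub_cancel, Pi.neg_apply]
    field_simp
    ring

theorem hasDerivAt_dh (a : ℝ) (z : ℂ) : HasDerivAt (dh a) (-a * dh a z) z := by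
  have := hasDerivAt_exp_mul (-a) z
  simpa [dh, neg_mul] using! this

/-- The quotient `q = -φ / ψ̄ = |z|^{2k} e^{2 i a Im z}`. -/
noncomputable def gaussRatio (k : ℕ) (a : ℝ) (z : ℂ) : ℂ :=
  (‖z‖ : ℂ) ^ (2 * k) * Complex.exp ((2 * a * z.im : ℝ) * Complex.I)

theorem norm_gaussRatio (k : ℕ) (a : ℝ) (z : ℂ) : ‖gaussRatio k a z‖ = ‖z‖ ^ (2 * k) := by
  rw [gaussRatio, norm_mul, Complex.norm_exp_ofReal_mul_I, mul_one, norm_pow, Complex.norm_real,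
    norm_norm]

theorem gaussRatio_mul_conj_psi (k : ℕ) (a : ℝ) {z : ℂ} (hz : z ≠ 0) :
    gaussRatio k a z * conj (psi k a z) = -phi k a z := by
  have hzc : conj z ≠ 0 := by simpa using hz
  have h1 : (‖z‖ : ℂ) ^ (2 * k) = z ^ k * conj z ^ k := by
    rw [pow_mul, ← Complex.mul_conj', mul_pow]
  have h2 : Complex.exp (a * z) =
      Complex.exp ((2 * a * z.im : ℝ) * Complex.I) * Complex.exp (a * conj z) := by
    rw [← Complex.exp_add]
    congr 1
    apply Complex.ext <;> simp
    ring
  simp only [gaussRatio, psi, phi, map_div₀, map_neg, map_pow, ← Complex.exp_conj, map_mul,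
    Complex.conj_ofReal]
  rw [h1, h2]
  field_simp

/-- This is where `a < π / 2` enters: `q = -1` forces `|z| = 1`, hence `|2 a Im z| < π`. -/
theorem one_add_gaussRatio_ne_zero {k : ℕ} {a : ℝ} (hk : k ≠ 0) (ha : 0 < a)
    (ha' : a < Real.pi / 2) (z : ℂ) : 1 + gaussRatio k a z ≠ 0 := by
  intro h0
  have h1 : gaussRatio k a z = -1 := by linear_combination h0
  have h2 : ‖z‖ = 1 := by
    have := norm_gaussRatio k a z
    rw [h1, norm_neg, norm_one] at this
    exact (pow_eq_one_iff_of_nonneg (norm_nonneg z) (by omega)).1 this.symm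
  rw [gaussRatio, h2, Complex.ofReal_one, one_pow, one_mul] at h1
  have h3 : Real.cos (2 * a * z.im) = -1 := by
    have := congrArg Complex.re h1
    rwa [Complex.exp_ofReal_mul_I_re] at this
  have h4 : |2 * a * z.im| < Real.pi := by
    have h5 : |z.im| ≤ 1 := h2 ▸ Complex.abs_im_le_norm z
    rw [abs_mul, abs_of_pos (by linarith : 0 < 2 * a)]
    nlinarith
  have h6 := Real.cos_lt_cos_of_nonneg_of_le_pi (abs_nonneg _) le_rfl h4
  rw [Real.cos_abs, Real.cos_pi, h3] at h6
  exact lt_irrefl _ h6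

theorem continuous_gaussRatio (k : ℕ) (a : ℝ) : Continuous (gaussRatio k a) := by
  unfold gaussRatio
  fun_prop

/-- `|1 + q|` is bounded below by a multiple of `1 + |q|`, uniformly in `z`: for `|z| ≤ 2` by
compactness, and for larger `|z|` by the triangle inequality. -/
theorem exists_le_norm_one_add_gaussRatio {k : ℕ} {a : ℝ} (hk : k ≠ 0) (ha : 0 < a)
    (ha' : a < Real.pi / 2) :
    ∃ c : ℝ, 0 < c ∧ ∀ z, c * (1 + ‖z‖ ^ (2 * k)) ≤ ‖1 + gaussRatio k a z‖ := by
  have hpos : ∀ z : ℂ, 0 < 1 + ‖z‖ ^ (2 * k) := fun z => by positivity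
  have hcont : Continuous fun z : ℂ => ‖1 + gaussRatio k a z‖ / (1 + ‖z‖ ^ (2 * k)) :=
    ((continuous_const.add (continuous_gaussRatio k a)).norm).div (by fun_prop)
      fun z => (hpos z).ne'
  obtain ⟨z₀, -, hz₀⟩ := (isCompact_closedBall (0 : ℂ) 2).exists_isMinOn
    ⟨0, by simp⟩ hcont.continuousOn
  have hm : 0 < ‖1 + gaussRatio k a z₀‖ / (1 + ‖z₀‖ ^ (2 * k)) :=
    div_pos (norm_pos_iff.2 (one_add_gaussRatio_ne_zero hk ha ha' z₀)) (hpos z₀)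
  refine ⟨min (1 / 2) _, lt_min (by norm_num) hm, fun z => ?_⟩
  by_cases hz : ‖z‖ ≤ 2
  · have := isMinOn_iff.1 hz₀ z (by simpa using hz)
    rw [← le_div_iff₀ (hpos z)]
    exact (min_le_right _ _).trans this
  · have h1 : (3 : ℝ) ≤ ‖z‖ ^ (2 * k) := by
      calc (3 : ℝ) ≤ 2 ^ 2 := by norm_num
        _ ≤ 2 ^ (2 * k) := pow_le_pow_right₀ (by norm_num) (by omega)
        _ ≤ ‖z‖ ^ (2 * k) := by gcongr; linarith
    have h2 : ‖z‖ ^ (2 * k) - 1 ≤ ‖1 + gaussRatio k a z‖ := by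
      have := norm_sub_norm_le (gaussRatio k a z) (-1)
      rw [norm_gaussRatio, norm_neg, norm_one, sub_neg_eq_add, add_comm (gaussRatio k a z)] at this
      exact this
    calc min (1 / 2) _ * (1 + ‖z‖ ^ (2 * k)) ≤ 1 / 2 * (1 + ‖z‖ ^ (2 * k)) := by
          gcongr; exact min_le_left _ _
      _ ≤ ‖1 + gaussRatio k a z‖ := by linarith

theorem phi_sub_conj_psi (k : ℕ) (a : ℝ) {z : ℂ} (hz : z ≠ 0) :
    phi k a z - conj (psi k a z) = -conj (psi k a z) * (1 + gaussRatio k a z) := by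
  linear_combination gaussRatio_mul_conj_psi k a hz

theorem psi_ne_zero (k : ℕ) (a : ℝ) {z : ℂ} (hz : z ≠ 0) : psi k a z ≠ 0 :=
  div_ne_zero (neg_ne_zero.2 (Complex.exp_ne_zero _)) (pow_ne_zero k hz)

theorem regularityCondition_example {k : ℕ} {a : ℝ} (hk : k ≠ 0) (ha : 0 < a)
    (ha' : a < Real.pi / 2) :
    RegularityCondition (phi k a) (psi k a) (dh a) puncturedPlane := by
  refine ⟨⟨fun z hz => ?_, fun z hz => ?_, fun z _ => ?_⟩, fun z hz h0 => ?_,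
    fun z _ => Complex.exp_ne_zero _⟩
  · exact (hasDerivAt_phi k a hz).differentiableAt.differentiableWithinAt
  · exact (hasDerivAt_psi k a hz).differentiableAt.differentiableWithinAt
  · exact (hasDerivAt_dh a z).differentiableAt.differentiableWithinAt
  · have h1 := phi_sub_conj_psi k a hz
    rw [h0, sub_self] at h1
    exact mul_ne_zero (neg_ne_zero.2 (by simpa using psi_ne_zero k a hz))
      (one_add_gaussRatio_ne_zero hk ha ha' z) h1.symm

/-- The four forms `φ dh = z^k dz`, `ψ dh = -z^{-k} dz`, `dh` and `φ ψ dh = -e^{az} dz` are exact;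
for the second one this needs `k ≠ 1`. -/
theorem exists_primitives {k : ℕ} {a : ℝ} (hk : 2 ≤ k) (ha : 0 < a) :
    ∃ A B C D : ℂ → ℂ,
      (∀ z ∈ puncturedPlane, HasDerivAt A (phi k a z * dh a z) z) ∧
      (∀ z ∈ puncturedPlane, HasDerivAt B (psi k a z * dh a z) z) ∧
      (∀ z ∈ puncturedPlane, HasDerivAt C (dh a z) z) ∧
      (∀ z ∈ puncturedPlane, HasDerivAt D (phi k a z * psi k a z * dh a z) z) := by
  obtain ⟨m, rfl⟩ : ∃ m, k = m + 2 := ⟨k - 2, by omega⟩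
  have ha0 : (a : ℂ) ≠ 0 := by exact_mod_cast ha.ne'
  have hexp : ∀ z : ℂ, Complex.exp (a * z) * dh a z = 1 := fun z => by
    rw [dh, ← Complex.exp_add, add_neg_cancel, Complex.exp_zero]
  refine ⟨fun z => z ^ (m + 3) / (m + 3), fun z => (z⁻¹) ^ (m + 1) / (m + 1),
    fun z => dh a z / -a, fun z => Complex.exp (a * z) / -a, fun z _ => ?_, fun z hz => ?_,
    fun z _ => ?_, fun z hz => ?_⟩
  · refine ((hasDerivAt_pow (m + 3) z).div_const _).congr_deriv ?_
    have : (m + 3 : ℂ) ≠ 0 := by exact_mod_cast (by omega : m + 3 ≠ 0)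
    rw [phi, mul_assoc, hexp]
    push_cast
    field_simp
  · have hz0 : z ≠ 0 := hz
    refine (((hasDerivAt_inv hz0).pow (m + 1)).div_const _).congr_deriv ?_
    have : (m + 1 : ℂ) ≠ 0 := by exact_mod_cast (by omega : m + 1 ≠ 0)
    have h1 : psi (m + 2) a z * dh a z = -(z⁻¹) ^ (m + 2) := by
      rw [psi, div_mul_eq_mul_div, neg_mul, hexp, inv_pow, neg_div, one_div]
    rw [h1]
    simp only [Nat.add_sub_cancel, inv_pow]
    push_cast
    field_simp
    ring
  · refine ((hasDerivAt_dh a z).div_const _).congr_deriv ?_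
    field_simp
  · have hz0 : z ≠ 0 := hz
    refine ((hasDerivAt_exp_mul a z).div_const _).congr_deriv ?_
    rw [mul_assoc (phi _ _ _), phi, psi, div_mul_eq_mul_div, neg_mul, hexp]
    field_simp

theorem curvatureDensity_example (k : ℕ) (a : ℝ) {z : ℂ} (hz : z ≠ 0)
    (h1 : 1 + gaussRatio k a z ≠ 0) :
    curvatureDensity (phi k a) (psi k a) z =
      (k / z + a) * (k / conj z - a) * (gaussRatio k a z / (1 + gaussRatio k a z) ^ 2) := by
  rw [curvatureDensity, (hasDerivAt_phi k a hz).deriv, (hasDerivAt_psi k a hz).deriv,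
    phi_sub_conj_psi k a hz]
  have h2 : conj (psi k a z) ≠ 0 := by simpa using psi_ne_zero k a hz
  have h3 : phi k a z = -(gaussRatio k a z * conj (psi k a z)) := by
    rw [gaussRatio_mul_conj_psi k a hz, neg_neg]
  have hzc : conj z ≠ 0 := by simpa using hz
  rw [h3]
  simp only [map_mul, map_sub, map_div₀, Complex.conj_ofReal, map_natCast]
  field_simp
  ring

theorem conformalFactor_example (k : ℕ) (a : ℝ) {z : ℂ} (hz : z ≠ 0) :
    conformalFactor (phi k a) (psi k a) (dh a) z =
      (2 * ‖1 + gaussRatio k a z‖ / ‖z‖ ^ k) ^ 2 := by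
  have h1 : Complex.normSq (psi k a z) * Complex.normSq (dh a z) = ((‖z‖ ^ k)⁻¹) ^ 2 := by
    have : psi k a z * dh a z = -(z ^ k)⁻¹ := by
      rw [psi, dh, div_mul_eq_mul_div, neg_mul, ← Complex.exp_add, add_neg_cancel,
        Complex.exp_zero, neg_div, one_div]
    rw [← map_mul, this, Complex.normSq_eq_norm_sq, norm_neg, norm_inv, norm_pow]
  rw [conformalFactor, phi_sub_conj_psi k a hz, map_mul, Complex.normSq_neg, Complex.normSq_conj,
    Complex.normSq_eq_norm_sq (1 + gaussRatio k a z)]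
  have hz' : ‖z‖ ≠ 0 := by simpa using hz
  calc _ = 4 * ‖1 + gaussRatio k a z‖ ^ 2 *
        (Complex.normSq (psi k a z) * Complex.normSq (dh a z)) := by ring
    _ = _ := by rw [h1]; field_simp; ring

theorem isCompleteSurface_example {k : ℕ} {a : ℝ} (hk : 2 ≤ k) (ha : 0 < a)
    (ha' : a < Real.pi / 2) {x : ℂ → Fin 4 → ℝ}
    (hx : IsWeierstrassSurface (phi k a) (psi k a) (dh a) puncturedPlane x) :
    IsCompleteSurface x puncturedPlane := by
  have hk0 : k ≠ 0 := by omega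
  have hr := regularityCondition_example hk0 ha ha'
  obtain ⟨c, hc, hle⟩ := exists_le_norm_one_add_gaussRatio hk0 ha ha'
  have hlow : ∀ z ∈ puncturedPlane, ∀ s : ℝ, 0 ≤ s → s * ‖z‖ ^ k ≤ 1 + ‖z‖ ^ (2 * k) →
      c * s ≤ 2 * ‖1 + gaussRatio k a z‖ / ‖z‖ ^ k := by
    intro z hz s hs0 hs
    have hz0 : 0 < ‖z‖ := norm_pos_iff.2 hz
    rw [le_div_iff₀ (by positivity)]
    have h1 := hle z
    nlinarith [mul_le_mul_of_nonneg_left hs hc.le, norm_nonneg (1 + gaussRatio k a z)]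
  refine isCompleteSurface_of_le hc (f := fun z => 2 * ‖1 + gaussRatio k a z‖ / ‖z‖ ^ k)
    ?_ ?_ ?_ ?_
  · refine ContinuousOn.div ?_ (by fun_prop) fun z hz => pow_ne_zero k (norm_ne_zero_iff.2 hz)
    exact (continuous_const.mul
      (continuous_const.add (continuous_gaussRatio k a)).norm).continuousOn
  · intro z hz b
    rw [hx.firstForm_eq hr isOpen_puncturedPlane hz, conformalFactor_example k a hz,
      Complex.mul_conj, Complex.ofReal_re, Complex.normSq_eq_norm_sq, ← mul_pow,
      Real.sqrt_sq (by positivity)]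
  · intro z hz
    have h1 := hlow z hz 1 zero_le_one (by
      rw [one_mul, pow_mul', sq]
      nlinarith [sq_nonneg (‖z‖ ^ k - 1), sq_nonneg (‖z‖ ^ k)])
    rwa [mul_one] at h1
  · intro z hz
    have hz0 : 0 < ‖z‖ := norm_pos_iff.2 hz
    rw [div_eq_mul_inv]
    refine hlow z hz _ (by positivity) ?_
    obtain ⟨m, rfl⟩ : ∃ m, k = m + 2 := ⟨k - 2, by omega⟩
    have e : (‖z‖ ^ 2)⁻¹ * ‖z‖ ^ (m + 2) = ‖z‖ ^ m := by
      rw [pow_add]; field_simp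
    rw [e]
    rcases le_total ‖z‖ 1 with h | h
    · have := pow_le_one₀ (n := m) hz0.le h
      have : 0 ≤ ‖z‖ ^ (2 * (m + 2)) := by positivity
      linarith
    · have := pow_le_pow_right₀ h (by omega : m ≤ 2 * (m + 2))
      linarith

/-! ### The total curvature of the examples -/

theorem one_add_pow_four_le {k : ℕ} (hk : 2 ≤ k) {r : ℝ} (hr : 0 ≤ r) :
    (1 + r) ^ 4 ≤ 16 * (1 + r ^ (2 * k)) := by
  have h0 : 0 ≤ r ^ (2 * k) := by positivity
  rcases le_total r 1 with h | h
  · calc (1 + r) ^ 4 ≤ (1 + 1) ^ 4 := by gcongr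
      _ ≤ _ := by linarith
  · calc (1 + r) ^ 4 ≤ (r + r) ^ 4 := by gcongr
      _ = 16 * r ^ 4 := by ring
      _ ≤ 16 * r ^ (2 * k) := by
        linarith [pow_le_pow_right₀ h (by omega : 4 ≤ 2 * k)]
      _ ≤ _ := by linarith

theorem pow_le_one_add_pow {r : ℝ} (hr : 0 ≤ r) {m n : ℕ} (hmn : m ≤ n) : r ^ m ≤ 1 + r ^ n := by
  have h0 : 0 ≤ r ^ n := by positivity
  rcases le_total r 1 with h | h
  · linarith [pow_le_one₀ (n := m) hr h]
  · linarith [pow_le_pow_right₀ h hmn]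

theorem div_one_add_pow_le {k : ℕ} (hk : 2 ≤ k) {r : ℝ} (hr : 0 ≤ r) :
    (1 + r) / (1 + r ^ (2 * k)) ≤ 16 * (1 + r) ^ (-3 : ℝ) := by
  have h1 := one_add_pow_four_le hk hr
  have h2 : (0 : ℝ) < 1 + r := by linarith
  have h3 : 0 < 1 + r ^ (2 * k) := by positivity
  rw [Real.rpow_neg h2.le, show (3 : ℝ) = ((3 : ℕ) : ℝ) by norm_num, Real.rpow_natCast,
    ← div_eq_mul_inv, div_le_div_iff₀ h3 (by positivity)]
  calc (1 + r) * (1 + r) ^ 3 = (1 + r) ^ 4 := by ring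
    _ ≤ _ := h1

theorem integrableOn_Ioi_one_add_rpow : IntegrableOn (fun r : ℝ => (1 + r) ^ (-3 : ℝ)) (Ioi 0) := by
  have h : Integrable (fun r : ℝ => (1 + ‖r‖) ^ (-3 : ℝ)) :=
    integrable_one_add_norm (by simp)
  refine h.integrableOn.congr_fun (fun r hr => ?_) measurableSet_Ioi
  simp only [Real.norm_of_nonneg (le_of_lt (mem_Ioi.1 hr))]

section Polar

variable (k : ℕ) (a : ℝ)

/-- `gaussRatio` in polar coordinates. -/
noncomputable def polarRatio (r θ : ℝ) : ℂ :=
  (r : ℂ) ^ (2 * k) * Complex.exp ((2 * a * (r * Real.sin θ) : ℝ) * Complex.I)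

/-- The potential `P = (a z̄ - k) / (1 + q)` in polar coordinates. Since
`∂_z (P / z̄)` is the curvature density `J`, one has `2 r J = P_r - (i / r) P_θ`. -/
noncomputable def polarPotential (r θ : ℝ) : ℂ :=
  (a * r * Complex.exp (-θ * Complex.I) - k) / (1 + polarRatio k a r θ)

/-- The radial derivative of `polarPotential`. -/
noncomputable def polarPotentialDr (r θ : ℝ) : ℂ :=
  a * Complex.exp (-θ * Complex.I) / (1 + polarRatio k a r θ)
    - (a * r * Complex.exp (-θ * Complex.I) - k)
      * ((2 * k * (r : ℂ) ^ (2 * k - 1) + (r : ℂ) ^ (2 * k) * (2 * a * Real.sin θ * Complex.I))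
        * Complex.exp ((2 * a * (r * Real.sin θ) : ℝ) * Complex.I))
      / (1 + polarRatio k a r θ) ^ 2

/-- The angular derivative of `polarPotential`, divided by `r`. -/
noncomputable def polarPotentialDt (r θ : ℝ) : ℂ :=
  -Complex.I * a * Complex.exp (-θ * Complex.I) / (1 + polarRatio k a r θ)
    - (a * r * Complex.exp (-θ * Complex.I) - k)
      * (polarRatio k a r θ * (2 * a * Real.cos θ * Complex.I))
      / (1 + polarRatio k a r θ) ^ 2

theorem gaussRatio_polar (r θ : ℝ) :
    gaussRatio k a (r * Complex.exp (θ * Complex.I)) = polarRatio k a r θ := by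
  have h1 : (r * Complex.exp (θ * Complex.I) : ℂ).im = r * Real.sin θ := by
    simp [Complex.exp_ofReal_mul_I_im]
  have h2 : ‖(r * Complex.exp (θ * Complex.I) : ℂ)‖ = |r| := by
    simp [Complex.norm_exp_ofReal_mul_I]
  rw [gaussRatio, h1, h2, polarRatio]
  congr 1
  norm_cast
  rw [pow_mul, pow_mul, sq_abs]

theorem norm_exp_neg_mul_I (θ : ℝ) : ‖Complex.exp (-θ * Complex.I)‖ = 1 := by
  have := Complex.norm_exp_ofReal_mul_I (-θ)
  simpa using this

theorem continuous_polarRatio : Continuous fun p : ℝ × ℝ => polarRatio k a p.1 p.2 := by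
  unfold polarRatio
  fun_prop

variable {k a}

theorem one_add_polarRatio_ne_zero (hk : k ≠ 0) (ha : 0 < a) (ha' : a < Real.pi / 2) (r θ : ℝ) :
    1 + polarRatio k a r θ ≠ 0 := by
  rw [← gaussRatio_polar]
  exact one_add_gaussRatio_ne_zero hk ha ha' _

theorem continuous_polarPotentialDr (hk : k ≠ 0) (ha : 0 < a) (ha' : a < Real.pi / 2) :
    Continuous fun p : ℝ × ℝ => polarPotentialDr k a p.1 p.2 := by
  have h1 := continuous_polarRatio k a
  have h0 := one_add_polarRatio_ne_zero hk ha ha'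
  unfold polarPotentialDr
  refine Continuous.sub (Continuous.div (by fun_prop) (by fun_prop) fun p => h0 _ _)
    (Continuous.div (by fun_prop) (by fun_prop) fun p => pow_ne_zero 2 (h0 _ _))

theorem continuous_polarPotentialDt (hk : k ≠ 0) (ha : 0 < a) (ha' : a < Real.pi / 2) :
    Continuous fun p : ℝ × ℝ => polarPotentialDt k a p.1 p.2 := by
  have h1 := continuous_polarRatio k a
  have h0 := one_add_polarRatio_ne_zero hk ha ha'
  unfold polarPotentialDt
  refine Continuous.sub (Continuous.div (by fun_prop) (by fun_prop) fun p => h0 _ _)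
    (Continuous.div (by fun_prop) (by fun_prop) fun p => pow_ne_zero 2 (h0 _ _))

theorem hasDerivAt_polarPotential_left (hk : k ≠ 0) (ha : 0 < a) (ha' : a < Real.pi / 2)
    (r θ : ℝ) : HasDerivAt (fun r => polarPotential k a r θ) (polarPotentialDr k a r θ) r := by
  have hid : HasDerivAt (fun r : ℝ => (r : ℂ)) 1 r := (hasDerivAt_id r).ofReal_comp
  have hnum : HasDerivAt (fun r : ℝ => (a : ℂ) * r * Complex.exp (-θ * Complex.I) - k)
      (a * Complex.exp (-θ * Complex.I)) r :=
    (((hid.const_mul (a : ℂ)).mul_const _).sub_const _).congr_deriv (by ring)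
  have hph : HasDerivAt (fun r : ℝ => ((2 * a * (r * Real.sin θ) : ℝ) : ℂ) * Complex.I)
      (2 * a * Real.sin θ * Complex.I) r := by
    have := ((((hasDerivAt_id r).mul_const (Real.sin θ)).const_mul (2 * a)).ofReal_comp).mul_const
      Complex.I
    refine this.congr_deriv ?_
    push_cast
    ring
  have hq : HasDerivAt (fun r => 1 + polarRatio k a r θ) _ r :=
    ((hid.pow (2 * k)).mul hph.cexp).const_add 1
  refine (hnum.div hq (one_add_polarRatio_ne_zero hk ha ha' r θ)).congr_deriv ?_
  have h0 := one_add_polarRatio_ne_zero hk ha ha' r θ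
  rw [polarPotentialDr]
  field_simp
  push_cast
  simp only [Pi.pow_apply]
  ring

theorem hasDerivAt_polarPotential_right (hk : k ≠ 0) (ha : 0 < a) (ha' : a < Real.pi / 2)
    (r θ : ℝ) : HasDerivAt (fun θ => polarPotential k a r θ) (r * polarPotentialDt k a r θ) θ := by
  have hid : HasDerivAt (fun θ : ℝ => (θ : ℂ)) 1 θ := (hasDerivAt_id θ).ofReal_comp
  have hnum : HasDerivAt (fun θ : ℝ => (a : ℂ) * r * Complex.exp (-θ * Complex.I) - k)
      (a * r * (Complex.exp (-θ * Complex.I) * -Complex.I)) θ :=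
    (((hid.neg.mul_const Complex.I).cexp.const_mul _).sub_const _).congr_deriv (by simp)
  have hph : HasDerivAt (fun θ : ℝ => ((2 * a * (r * Real.sin θ) : ℝ) : ℂ) * Complex.I)
      (2 * a * (r * Real.cos θ) * Complex.I) θ := by
    have := ((((Real.hasDerivAt_sin θ).const_mul r).const_mul (2 * a)).ofReal_comp).mul_const
      Complex.I
    refine this.congr_deriv ?_
    push_cast
    ring
  have hq : HasDerivAt (fun θ => 1 + polarRatio k a r θ) _ θ :=
    (hph.cexp.const_mul _).const_add 1
  refine (hnum.div hq (one_add_polarRatio_ne_zero hk ha ha' r θ)).congr_deriv ?_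
  have h0 := one_add_polarRatio_ne_zero hk ha ha' r θ
  rw [polarPotentialDt]
  field_simp
  rw [polarRatio]
  push_cast
  ring_nf

/-- The curvature density is in divergence form. -/
theorem mul_curvatureDensity_polar (hk : k ≠ 0) (ha : 0 < a) (ha' : a < Real.pi / 2) {r : ℝ}
    (hr : r ≠ 0) (θ : ℝ) :
    r * curvatureDensity (phi k a) (psi k a) (r * Complex.exp (θ * Complex.I)) =
      1 / 2 * (polarPotentialDr k a r θ - Complex.I * polarPotentialDt k a r θ) := by
  have h0 := one_add_polarRatio_ne_zero hk ha ha' r θ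
  have hr' : (r : ℂ) ≠ 0 := by exact_mod_cast hr
  have hE := Complex.exp_ne_zero (θ * Complex.I)
  have hz : (r * Complex.exp (θ * Complex.I) : ℂ) ≠ 0 := mul_ne_zero hr' hE
  rw [curvatureDensity_example k a hz (one_add_gaussRatio_ne_zero hk ha ha' _),
    gaussRatio_polar, map_mul, Complex.conj_ofReal, ← Complex.exp_conj, map_mul,
    Complex.conj_ofReal, Complex.conj_I]
  have hneg : Complex.exp (θ * -Complex.I) = (Complex.exp (θ * Complex.I))⁻¹ := by
    rw [mul_neg, Complex.exp_neg]
  have hneg' : Complex.exp (-θ * Complex.I) = (Complex.exp (θ * Complex.I))⁻¹ := by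
    rw [neg_mul, Complex.exp_neg]
  have hcs : Complex.exp (θ * Complex.I) = Real.cos θ + Real.sin θ * Complex.I := by
    rw [Complex.exp_mul_I, Complex.ofReal_cos, Complex.ofReal_sin]
  obtain ⟨m, hm⟩ : ∃ m, 2 * k = m + 1 := ⟨2 * k - 1, by omega⟩
  have hQ : (2 * k * (r : ℂ) ^ (2 * k - 1) + (r : ℂ) ^ (2 * k) * (2 * a * Real.sin θ * Complex.I))
        * Complex.exp ((2 * a * (r * Real.sin θ) : ℝ) * Complex.I) =
      polarRatio k a r θ * (2 * k / r + 2 * a * Real.sin θ * Complex.I) := by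
    rw [polarRatio, hm, Nat.add_sub_cancel, pow_succ]
    field_simp
  rw [polarPotentialDr, polarPotentialDt, hQ, hneg, hneg']
  have hsin : (Real.sin θ : ℂ) * Complex.I = Complex.exp (θ * Complex.I) - Real.cos θ := by
    rw [hcs]; ring
  rw [mul_assoc (2 * (a : ℂ)) (Real.sin θ : ℂ), hsin]
  generalize Complex.exp (θ * Complex.I) = e at *
  generalize polarRatio k a r θ = q at *
  field_simp
  ring_nf
  simp only [Complex.I_sq]
  ring

/-- A common bound for the derivatives of the potential: each of them is
`u / (1 + q) - v w / (1 + q)²` with `|u| ≤ a`, `|v| ≤ a r + k`, `|w| ≤ 2 (a + k) (1 + r^{2k})`. -/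
theorem norm_div_sub_div_le {c r : ℝ} (hk : 2 ≤ k) (ha : 0 < a) (hc : 0 < c) (hr : 0 ≤ r)
    {u v w d : ℂ} (hd : c * (1 + r ^ (2 * k)) ≤ ‖d‖) (hu : ‖u‖ ≤ a) (hv : ‖v‖ ≤ a * r + k)
    (hw : ‖w‖ ≤ 2 * (a + k) * (1 + r ^ (2 * k))) :
    ‖u / d - v * w / d ^ 2‖ ≤ 16 * (a / c + 2 * (a + k) ^ 2 / c ^ 2) * (1 + r) ^ (-3 : ℝ) := by
  have hB : 0 < 1 + r ^ (2 * k) := by positivity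
  have h1 : ‖u / d‖ ≤ a / c * ((1 + r) / (1 + r ^ (2 * k))) := by
    rw [norm_div]
    calc ‖u‖ / ‖d‖ ≤ a / (c * (1 + r ^ (2 * k))) := by gcongr
      _ = a / c * (1 / (1 + r ^ (2 * k))) := by field_simp
      _ ≤ a / c * ((1 + r) / (1 + r ^ (2 * k))) := by gcongr; linarith
  have h2 : ‖v * w / d ^ 2‖ ≤ 2 * (a + k) ^ 2 / c ^ 2 * ((1 + r) / (1 + r ^ (2 * k))) := by
    rw [norm_div, norm_mul, norm_pow]
    have hv' : ‖v‖ ≤ (a + k) * (1 + r) := by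
      have : 0 ≤ k * r := by positivity
      nlinarith
    calc ‖v‖ * ‖w‖ / ‖d‖ ^ 2
        ≤ ((a + k) * (1 + r)) * (2 * (a + k) * (1 + r ^ (2 * k)))
          / (c * (1 + r ^ (2 * k))) ^ 2 := by gcongr
      _ = _ := by field_simp
  calc ‖u / d - v * w / d ^ 2‖ ≤ ‖u / d‖ + ‖v * w / d ^ 2‖ := norm_sub_le _ _
    _ ≤ (a / c + 2 * (a + k) ^ 2 / c ^ 2) * ((1 + r) / (1 + r ^ (2 * k))) := by
        rw [add_mul]; exact add_le_add h1 h2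
    _ ≤ (a / c + 2 * (a + k) ^ 2 / c ^ 2) * (16 * (1 + r) ^ (-3 : ℝ)) := by
        gcongr; exact div_one_add_pow_le hk hr
    _ = _ := by ring

theorem norm_numerator_le (ha : 0 < a) {r : ℝ} (hr : 0 ≤ r) (θ : ℝ) :
    ‖(a * r * Complex.exp (-θ * Complex.I) - k : ℂ)‖ ≤ a * r + k := by
  refine (norm_sub_le _ _).trans ?_
  rw [norm_mul, norm_mul, norm_exp_neg_mul_I]
  simp [abs_of_pos ha, abs_of_nonneg hr]

theorem norm_polarRatio {r : ℝ} (hr : 0 ≤ r) (θ : ℝ) : ‖polarRatio k a r θ‖ = r ^ (2 * k) := by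
  rw [polarRatio, norm_mul, Complex.norm_exp_ofReal_mul_I, mul_one, norm_pow, Complex.norm_real,
    Real.norm_of_nonneg hr]

theorem exists_polarPotential_bounds (hk : 2 ≤ k) (ha : 0 < a) (ha' : a < Real.pi / 2) :
    ∃ C : ℝ, ∀ r θ : ℝ, 0 ≤ r →
      ‖polarPotential k a r θ‖ ≤ C * (1 + r) ^ (-3 : ℝ) ∧
      ‖polarPotentialDr k a r θ‖ ≤ C * (1 + r) ^ (-3 : ℝ) ∧
      ‖polarPotentialDt k a r θ‖ ≤ C * (1 + r) ^ (-3 : ℝ) := by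
  obtain ⟨c, hc, hle⟩ := exists_le_norm_one_add_gaussRatio (by omega : k ≠ 0) ha ha'
  have hd : ∀ r θ : ℝ, 0 ≤ r → c * (1 + r ^ (2 * k)) ≤ ‖1 + polarRatio k a r θ‖ := by
    intro r θ hr
    have := hle (r * Complex.exp (θ * Complex.I))
    rwa [gaussRatio_polar, norm_mul, Complex.norm_exp_ofReal_mul_I, mul_one, Complex.norm_real,
      Real.norm_of_nonneg hr] at this
  set C₁ := 16 * (a / c + 2 * (a + k) ^ 2 / c ^ 2) with hC₁
  set C₂ := 16 * ((a + k) / c) with hC₂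
  have hC₁0 : 0 ≤ C₁ := by positivity
  have hC₂0 : 0 ≤ C₂ := by positivity
  refine ⟨C₁ + C₂, fun r θ hr => ?_⟩
  have hR : 0 ≤ (1 + r) ^ (-3 : ℝ) := by positivity
  have hB : 0 < 1 + r ^ (2 * k) := by positivity
  have hv := norm_numerator_le (k := k) ha hr θ
  have hmono : C₁ * (1 + r) ^ (-3 : ℝ) ≤ (C₁ + C₂) * (1 + r) ^ (-3 : ℝ) := by
    gcongr; linarith
  refine ⟨?_, ?_, ?_⟩
  · rw [polarPotential, norm_div]
    have hv' : a * r + k ≤ (a + k) * (1 + r) := by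
      have : 0 ≤ k * r := by positivity
      nlinarith
    calc _ ≤ (a + k) * (1 + r) / (c * (1 + r ^ (2 * k))) := by
          gcongr
          · exact hv.trans hv'
          · exact hd r θ hr
      _ = (a + k) / c * ((1 + r) / (1 + r ^ (2 * k))) := by field_simp
      _ ≤ (a + k) / c * (16 * (1 + r) ^ (-3 : ℝ)) := by
          gcongr; exact div_one_add_pow_le hk hr
      _ = C₂ * (1 + r) ^ (-3 : ℝ) := by rw [hC₂]; ring
      _ ≤ _ := by gcongr; linarith
  · refine le_trans ?_ hmono
    refine norm_div_sub_div_le hk ha hc hr (hd r θ hr) ?_ hv ?_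
    · rw [norm_mul, norm_exp_neg_mul_I]
      simp [abs_of_pos ha]
    · rw [norm_mul, Complex.norm_exp_ofReal_mul_I, mul_one]
      have h1 : ‖(2 * k * (r : ℂ) ^ (2 * k - 1) : ℂ)‖ = 2 * k * r ^ (2 * k - 1) := by
        simp [abs_of_nonneg hr]
      have h2 : ‖((r : ℂ) ^ (2 * k) * (2 * a * Real.sin θ * Complex.I) : ℂ)‖ ≤
          r ^ (2 * k) * (2 * a) := by
        simp only [norm_mul, norm_pow, Complex.norm_real, Complex.norm_I, mul_one,
          Real.norm_of_nonneg hr, Real.norm_of_nonneg ha.le, Complex.norm_ofNat]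
        have := Real.abs_sin_le_one θ
        rw [Real.norm_eq_abs]
        refine mul_le_mul_of_nonneg_left ?_ (by positivity)
        nlinarith
      refine (norm_add_le _ _).trans ?_
      have h3 := pow_le_one_add_pow hr (by omega : 2 * k - 1 ≤ 2 * k)
      rw [h1]
      calc _ ≤ 2 * k * (1 + r ^ (2 * k)) + (1 + r ^ (2 * k)) * (2 * a) := by
            refine add_le_add (by gcongr) (h2.trans ?_)
            gcongr; linarith
        _ = _ := by ring
  · refine le_trans ?_ hmono
    refine norm_div_sub_div_le hk ha hc hr (hd r θ hr) ?_ hv ?_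
    · rw [norm_mul, norm_exp_neg_mul_I]
      simp [abs_of_pos ha]
    · rw [norm_mul, norm_polarRatio hr]
      have h2 : ‖(2 * a * Real.cos θ * Complex.I : ℂ)‖ ≤ 2 * (a + k) := by
        simp only [norm_mul, Complex.norm_real, Complex.norm_I, mul_one,
          Real.norm_of_nonneg ha.le, Complex.norm_ofNat]
        have := Real.abs_cos_le_one θ
        rw [Real.norm_eq_abs]
        have hk0 : (0 : ℝ) ≤ k := by positivity
        nlinarith
      calc _ ≤ (1 + r ^ (2 * k)) * (2 * (a + k)) := by
            gcongr; linarith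
        _ = _ := by ring

theorem integrableOn_polar_of_le {f : ℝ × ℝ → ℂ} (hf : Continuous f) {C : ℝ}
    (hC : ∀ r θ : ℝ, 0 ≤ r → ‖f (r, θ)‖ ≤ C * (1 + r) ^ (-3 : ℝ)) :
    IntegrableOn f (Ioi 0 ×ˢ Ioo (-Real.pi) Real.pi) := by
  have h1 : IntegrableOn (fun p : ℝ × ℝ => C * (1 + p.1) ^ (-3 : ℝ))
      (Ioi 0 ×ˢ Ioo (-Real.pi) Real.pi) := by
    rw [IntegrableOn, Measure.volume_eq_prod, ← Measure.prod_restrict]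
    exact Integrable.comp_fst (integrableOn_Ioi_one_add_rpow.const_mul C) _
  refine Integrable.mono' h1 hf.aestronglyMeasurable ?_
  filter_upwards [self_mem_ae_restrict (measurableSet_Ioi.prod measurableSet_Ioo)] with p hp
  exact hC p.1 p.2 (le_of_lt hp.1)

theorem integral_polarPotentialDr (hk : 2 ≤ k) (ha : 0 < a) (ha' : a < Real.pi / 2) :
    ∫ p in Ioi (0 : ℝ) ×ˢ Ioo (-Real.pi) Real.pi, polarPotentialDr k a p.1 p.2 =
      2 * Real.pi * k := by
  obtain ⟨C, hC⟩ := exists_polarPotential_bounds hk ha ha'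
  have hk0 : k ≠ 0 := by omega
  have hcont := continuous_polarPotentialDr hk0 ha ha'
  have hint := integrableOn_polar_of_le hcont fun r θ hr => (hC r θ hr).2.1
  rw [IntegrableOn, Measure.volume_eq_prod, ← Measure.prod_restrict] at hint
  have hinner : ∀ θ : ℝ, ∫ r in Ioi (0 : ℝ), polarPotentialDr k a r θ = k := by
    intro θ
    have hi : IntegrableOn (fun r => polarPotentialDr k a r θ) (Ioi 0) := by
      refine Integrable.mono' (integrableOn_Ioi_one_add_rpow.const_mul C)
        (hcont.comp (by fun_prop : Continuous fun r : ℝ => (r, θ))).aestronglyMeasurable ?_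
      filter_upwards [self_mem_ae_restrict measurableSet_Ioi] with r hr
      exact (hC r θ (le_of_lt hr)).2.1
    have hlim : Tendsto (fun r => polarPotential k a r θ) atTop (𝓝 0) := by
      have h1 : Tendsto (fun r : ℝ => C * (1 + r) ^ (-3 : ℝ)) atTop (𝓝 0) := by
        have := ((tendsto_rpow_neg_atTop (by norm_num : (0 : ℝ) < 3)).comp
          (tendsto_atTop_add_const_left atTop (1 : ℝ) tendsto_id)).const_mul C
        simpa using this
      refine squeeze_zero_norm' ?_ h1
      filter_upwards [eventually_ge_atTop 0] with r hr using (hC r θ hr).1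
    rw [integral_Ioi_of_hasDerivAt_of_tendsto
      (hasDerivAt_polarPotential_left hk0 ha ha' 0 θ).continuousAt.continuousWithinAt
      (fun r _ => hasDerivAt_polarPotential_left hk0 ha ha' r θ) hi hlim]
    simp [polarPotential, polarRatio, hk0]
  rw [Measure.volume_eq_prod, ← Measure.prod_restrict, integral_prod_symm _ hint]
  simp only [hinner]
  have hvol : volume.real (Ioo (-Real.pi) Real.pi) = 2 * Real.pi := by
    rw [Real.volume_real_Ioo_of_le (by linarith [Real.pi_pos])]
    ring
  rw [setIntegral_const, hvol, Complex.real_smul]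
  push_cast
  ring

theorem integral_polarPotentialDt (hk : 2 ≤ k) (ha : 0 < a) (ha' : a < Real.pi / 2) :
    ∫ p in Ioi (0 : ℝ) ×ˢ Ioo (-Real.pi) Real.pi, polarPotentialDt k a p.1 p.2 = 0 := by
  obtain ⟨C, hC⟩ := exists_polarPotential_bounds hk ha ha'
  have hk0 : k ≠ 0 := by omega
  have hcont := continuous_polarPotentialDt hk0 ha ha'
  have hint := integrableOn_polar_of_le hcont fun r θ hr => (hC r θ hr).2.2
  rw [IntegrableOn, Measure.volume_eq_prod, ← Measure.prod_restrict] at hint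
  rw [Measure.volume_eq_prod, ← Measure.prod_restrict, integral_prod _ hint]
  refine setIntegral_eq_zero_of_forall_eq_zero fun r hr => ?_
  have hr0 : (r : ℂ) ≠ 0 := by exact_mod_cast (mem_Ioi.1 hr).ne'
  have h1 : ∫ θ in (-Real.pi)..Real.pi, r * polarPotentialDt k a r θ =
      polarPotential k a r Real.pi - polarPotential k a r (-Real.pi) := by
    refine intervalIntegral.integral_eq_sub_of_hasDerivAt
      (fun θ _ => hasDerivAt_polarPotential_right hk0 ha ha' r θ) ?_
    exact (continuous_const.mul (hcont.comp (by fun_prop : Continuous fun θ : ℝ => (r, θ)))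
      ).intervalIntegrable _ _
  have h2 : polarPotential k a r Real.pi = polarPotential k a r (-Real.pi) := by
    simp [polarPotential, polarRatio, Complex.exp_neg, Complex.exp_pi_mul_I]
  rw [h2, sub_self, intervalIntegral.integral_const_mul, mul_eq_zero, or_iff_right hr0,
    intervalIntegral.integral_of_le (by linarith [Real.pi_pos]),
    integral_Ioc_eq_integral_Ioo] at h1
  exact h1

theorem restrict_puncturedPlane : (volume : Measure ℂ).restrict puncturedPlane = volume :=
  Measure.restrict_eq_self_of_ae_mem (compl_mem_ae_iff.2 (measure_singleton 0))

theorem integral_curvatureDensity (hk : 2 ≤ k) (ha : 0 < a) (ha' : a < Real.pi / 2) :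
    ∫ z in puncturedPlane, curvatureDensity (phi k a) (psi k a) z = Real.pi * k := by
  obtain ⟨C, hC⟩ := exists_polarPotential_bounds hk ha ha'
  have hk0 : k ≠ 0 := by omega
  have hi1 := integrableOn_polar_of_le (continuous_polarPotentialDr hk0 ha ha')
    fun r θ hr => (hC r θ hr).2.1
  have hi2 := integrableOn_polar_of_le (continuous_polarPotentialDt hk0 ha ha')
    fun r θ hr => (hC r θ hr).2.2
  rw [restrict_puncturedPlane, ← Complex.integral_comp_polarCoord_symm, polarCoord_target]
  have h1 : ∫ p in Ioi (0 : ℝ) ×ˢ Ioo (-Real.pi) Real.pi,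
      p.1 • curvatureDensity (phi k a) (psi k a) (Complex.polarCoord.symm p) =
      ∫ p in Ioi (0 : ℝ) ×ˢ Ioo (-Real.pi) Real.pi,
        1 / 2 * (polarPotentialDr k a p.1 p.2 - Complex.I * polarPotentialDt k a p.1 p.2) := by
    refine setIntegral_congr_fun (measurableSet_Ioi.prod measurableSet_Ioo) fun p hp => ?_
    have hp0 : p.1 ≠ 0 := ne_of_gt hp.1
    rw [← mul_curvatureDensity_polar hk0 ha ha' hp0, Complex.real_smul,
      Complex.polarCoord_symm_apply, Complex.exp_mul_I, Complex.ofReal_cos, Complex.ofReal_sin]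
  rw [h1, integral_const_mul, integral_sub hi1 (hi2.const_mul _), integral_const_mul,
    integral_polarPotentialDr hk ha ha', integral_polarPotentialDt hk ha ha']
  ring

theorem integrableOn_curvatureDensity (hk : 2 ≤ k) (ha : 0 < a) (ha' : a < Real.pi / 2) :
    IntegrableOn (curvatureDensity (phi k a) (psi k a)) puncturedPlane := by
  have hk0 : k ≠ 0 := by omega
  obtain ⟨c, hc, hle⟩ := exists_le_norm_one_add_gaussRatio hk0 ha ha'
  have h4 : Integrable fun z : ℂ => 64 * (a + k) ^ 2 / c ^ 2 * (1 + ‖z‖) ^ (-4 : ℝ) :=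
    (integrable_one_add_norm (by simp; norm_num)).const_mul _
  have hform : EqOn (curvatureDensity (phi k a) (psi k a)) (fun z =>
      (k / z + a) * (k / conj z - a) * (gaussRatio k a z / (1 + gaussRatio k a z) ^ 2))
      puncturedPlane := fun z hz =>
    curvatureDensity_example k a hz (one_add_gaussRatio_ne_zero hk0 ha ha' z)
  have hmeas : ContinuousOn (fun z =>
      (k / z + a) * (k / conj z - a) * (gaussRatio k a z / (1 + gaussRatio k a z) ^ 2))
      puncturedPlane := by
    have hq := continuous_gaussRatio k a
    refine ContinuousOn.mul (ContinuousOn.mul ?_ ?_) (Continuous.continuousOn ?_)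
    · exact (continuousOn_const.div continuousOn_id fun z hz => hz).add continuousOn_const
    · refine (continuousOn_const.div Complex.continuous_conj.continuousOn
        fun z (hz : z ≠ 0) => ?_).sub continuousOn_const
      simpa using hz
    · exact hq.div (by fun_prop) fun z =>
        pow_ne_zero 2 (one_add_gaussRatio_ne_zero hk0 ha ha' z)
  refine IntegrableOn.congr_fun ?_ hform.symm isOpen_puncturedPlane.measurableSet
  refine Integrable.mono' h4.integrableOn
    (hmeas.aestronglyMeasurable isOpen_puncturedPlane.measurableSet) ?_
  filter_upwards [self_mem_ae_restrict isOpen_puncturedPlane.measurableSet] with z hz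
  have hz0 : z ≠ 0 := hz
  set r := ‖z‖ with hr_def
  have hr : 0 < r := norm_pos_iff.2 hz0
  have hB : 0 < 1 + r ^ (2 * k) := by positivity
  have hfac : (k + a * r) ≤ (a + k) * (1 + r) := by
    have : 0 ≤ k * r := by positivity
    nlinarith
  have e1 : ‖(k / z + a : ℂ)‖ ≤ (k + a * r) / r := by
    refine (norm_add_le _ _).trans_eq ?_
    rw [norm_div, Complex.norm_real, Real.norm_of_nonneg ha.le, Complex.norm_natCast, ← hr_def]
    field_simp
  have e2 : ‖(k / conj z - a : ℂ)‖ ≤ (k + a * r) / r := by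
    refine (norm_sub_le _ _).trans_eq ?_
    rw [norm_div, Complex.norm_real, Real.norm_of_nonneg ha.le, Complex.norm_natCast,
      Complex.norm_conj, ← hr_def]
    field_simp
  obtain ⟨m, rfl⟩ : ∃ m, k = m + 1 := ⟨k - 1, by omega⟩
  have hpow : r ^ (2 * (m + 1)) = r ^ (2 * m) * r ^ 2 := by ring
  -- `(1 + r)² r^{2k - 2} ≤ 4 (1 + r^{2k})`
  have h5 : (1 + r) ^ 2 * r ^ (2 * m) ≤ 4 * (1 + r ^ (2 * (m + 1))) := by
    have h6 := pow_le_one_add_pow hr.le (by omega : 2 * m ≤ 2 * (m + 1))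
    have h7 : 0 ≤ (1 - r) ^ 2 * r ^ (2 * m) := by positivity
    nlinarith
  have h8 := one_add_pow_four_le hk hr.le
  rw [norm_mul, norm_mul, norm_div, norm_pow, norm_gaussRatio, ← hr_def]
  calc _ ≤ ((a + (m + 1 : ℕ)) * (1 + r) / r) * ((a + (m + 1 : ℕ)) * (1 + r) / r)
        * (r ^ (2 * (m + 1)) / (c * (1 + r ^ (2 * (m + 1)))) ^ 2) := by
        gcongr
        · exact e1.trans (by gcongr)
        · exact e2.trans (by gcongr)
        · exact hle z
    _ = (a + (m + 1 : ℕ)) ^ 2 / c ^ 2 * (((1 + r) ^ 2 * r ^ (2 * m))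
        / (1 + r ^ (2 * (m + 1))) ^ 2) := by
        rw [hpow]; field_simp
    _ ≤ (a + (m + 1 : ℕ)) ^ 2 / c ^ 2 * (4 * (1 + r ^ (2 * (m + 1)))
        / (1 + r ^ (2 * (m + 1))) ^ 2) := by gcongr
    _ = (a + (m + 1 : ℕ)) ^ 2 / c ^ 2 * (4 / (1 + r ^ (2 * (m + 1)))) := by field_simp
    _ ≤ (a + (m + 1 : ℕ)) ^ 2 / c ^ 2 * (64 * (1 + r) ^ (-4 : ℝ)) := by
        gcongr
        rw [Real.rpow_neg (by positivity), show (4 : ℝ) = ((4 : ℕ) : ℝ) by norm_num,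
          Real.rpow_natCast, ← div_eq_mul_inv, div_le_div_iff₀ hB (by positivity)]
        push_cast
        linarith
    _ = _ := by ring

end Polar

end StationarySurface

open StationarySurface in
theorem proposition3p2 (k : ℕ) (a : ℝ) (hk : 2 ≤ k) (ha : 0 < a) (ha' : a < Real.pi / 2) :
    -- the regularity and period conditions, the ends, and the essential singularities
    RegularityCondition (phi k a) (psi k a) (dh a) puncturedPlane ∧
    PeriodCondition (phi k a) (psi k a) (dh a) puncturedPlane ∧
    HasTwoEndsZeroInfty puncturedPlane ∧
    HasEssentialSingularityAtInfty (phi k a) ∧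
    HasEssentialSingularityAtInfty (psi k a) ∧
    -- the surface with these data exists
    (∃ x : ℂ → Fin 4 → ℝ,
      IsWeierstrassSurface (phi k a) (psi k a) (dh a) puncturedPlane x) ∧
    ∀ x : ℂ → Fin 4 → ℝ,
      IsWeierstrassSurface (phi k a) (psi k a) (dh a) puncturedPlane x →
      -- it is a complete stationary surface, with isothermal coordinate z
      IsStationary x puncturedPlane ∧
      IsIsothermal x puncturedPlane ∧
      IsCompleteSurface x puncturedPlane ∧
      -- the total Gaussian curvature
      Integrable (gaussCurvature x) (areaMeasure x puncturedPlane) ∧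
      ∫ z, gaussCurvature x z ∂(areaMeasure x puncturedPlane) = -4 * Real.pi * k ∧
      -- the Gauss maps and the total normal curvature
      (∃ y ystar : ℂ → Fin 4 → ℝ, IsNullNormalFrame x puncturedPlane y ystar) ∧
      ∀ y ystar : ℂ → Fin 4 → ℝ, IsNullNormalFrame x puncturedPlane y ystar →
        Represents y (phi k a) puncturedPlane ∧
        Represents ystar (fun z => conj (psi k a z)) puncturedPlane ∧
        Integrable (fun z => -(gaussCurvature x z : ℂ) + Complex.I * normalCurvature x y ystar z)
          (areaMeasure x puncturedPlane) ∧
        ∫ z, normalCurvature x y ystar z ∂(areaMeasure x puncturedPlane) = 0 := by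
  have hr := regularityCondition_example (by omega : k ≠ 0) ha ha'
  have hU := isOpen_puncturedPlane
  obtain ⟨A, B, C, D, hA, hB, hC, hD⟩ := exists_primitives hk ha
  have hJi := integrableOn_curvatureDensity hk ha ha'
  have hJ := integral_curvatureDensity hk ha ha'
  refine ⟨hr, periodCondition_of_exact hr hA hB hC hD, hasTwoEndsZeroInfty_puncturedPlane,
    hasEssentialSingularityAtInfty_phi k ha, hasEssentialSingularityAtInfty_psi k ha,
    exists_isWeierstrassSurface_of_exact hr hA hB hC hD, fun x hx => ?_⟩
  have hK : ∀ z ∈ puncturedPlane, conformalFactor (phi k a) (psi k a) (dh a) z •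
      gaussCurvature x z = -4 * (curvatureDensity (phi k a) (psi k a) z).re := fun z hz =>
    hx.gaussCurvature_mul hr hU hz
  refine ⟨hx.isStationary hr hU, hx.isIsothermal hr hU, isCompleteSurface_example hk ha ha' hx,
    ?_, ?_, hx.exists_isNullNormalFrame hr hU, fun y ystar hy => ?_⟩
  · rw [hx.integrable_areaMeasure_iff hr hU hK]
    exact (Integrable.re hJi).const_mul (-4)
  · have h1 : ∫ z in puncturedPlane, (curvatureDensity (phi k a) (psi k a) z).re =
        (∫ z in puncturedPlane, curvatureDensity (phi k a) (psi k a) z).re := integral_re hJi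
    rw [hx.integral_areaMeasure_eq hr hU hK, integral_const_mul, h1, hJ]
    simp [mul_assoc]
  have hKn : ∀ z ∈ puncturedPlane, conformalFactor (phi k a) (psi k a) (dh a) z •
      normalCurvature x y ystar z = 4 * (curvatureDensity (phi k a) (psi k a) z).im := fun z hz =>
    hx.normalCurvature_mul hr hU hy hz
  have hne : ∀ z ∈ puncturedPlane, y z 2 + y z 3 ≠ 0 ∧ ystar z 2 + ystar z 3 ≠ 0 := by
    intro z hz
    have h := (hx.frame_eq_smul hr hU hy hz).2.2
    constructor <;> intro h0 <;> rw [h0] at h <;> norm_num at h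
  refine ⟨fun z hz => ⟨_, (hne z hz).1, (hx.frame_eq_smul hr hU hy hz).1⟩,
    fun z hz => ⟨_, (hne z hz).2, (hx.frame_eq_smul hr hU hy hz).2.1⟩, ?_, ?_⟩
  · rw [hx.integrable_areaMeasure_iff hr hU
      (g := fun z => 4 * curvatureDensity (phi k a) (psi k a) z) fun z hz => ?_]
    · exact hJi.const_mul 4
    · have h1 := hK z hz
      have h2 := hKn z hz
      rw [smul_eq_mul] at h1 h2
      apply Complex.ext <;> simp <;> linarith
  · have h1 : ∫ z in puncturedPlane, (curvatureDensity (phi k a) (psi k a) z).im =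
        (∫ z in puncturedPlane, curvatureDensity (phi k a) (psi k a) z).im := integral_im hJi
    rw [hx.integral_areaMeasure_eq hr hU hKn, integral_const_mul, h1, hJ]
    simp
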